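/- Let $G=(V,E)$ be a finite connected undirected simple graph with vertex set $V=\{1,\dots,n\}$, $n\ge 2$, where $E$ contains each edge in both orientations $(i,j)$ and $(j,i)$, and let $N(i)=\{j:(i,j)\in E\}$. Let $\Delta x>0$, $\beta>0$, $(v_i)\in\mathbb R^n$, and let $W=(w_{ij})$ be a real symmetric $n\times n$ matrix. Put $$\mathcal F(\rho)=\sum_i v_i\rho_i+\tfrac12\sum_{i,j}w_{ij}\rho_i\rho_j+\beta\sum_i\rho_i\log\rho_i,\qquad F_i=\frac{\partial\mathcal F}{\partial\rho_i},\qquad f_{ij}=\frac{\partial^2\mathcal F}{\partial\rho_i\partial\rho_j},$$ let $\mathcal P_o(G)=\{\rho\in\mathbb R^n:\rho_i>0,\ \sum_i\rho_i=1\}$, and let $(\cdot)_+=\max\{\cdot,0\}$. Consider on $\mathcal P_o(G)$ the ordinary differential equation $$\frac{d\rho_i}{dt}=\frac1{\Delta x^2}\Big\{\sum_{j\in N(i)}\rho_j\,(F_j(\rho)-F_i(\rho))_+-\sum_{j\in N(i)}\rho_i\,(F_i(\rho)-F_j(\rho))_+\Big\}.\tag{a1}$$ A Gibbs measure is a probability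 vector $\rho$ with $$\rho_i=\frac1K e^{-\frac1\beta\left(v_i+\sum_j w_{ij}\rho_j\right)}\quad(i\in V),\qquad K=\sum_{k} e^{-\frac1\beta\left(v_k+\sum_j w_{kj}\rho_j\right)}.$$ For $\rho\in\mathcal P_o(G)$ define $$\lambda_{\mathcal F}(\rho)=\min_{\Phi\in D}\ \sum_{(i,j)\in E}\sum_{(k,l)\in E}h_{ij,kl}\Big(\frac{\Phi_i-\Phi_j}{\Delta x}\Big)_+\rho_i\Big(\frac{\Phi_k-\Phi_l}{\Delta x}\Big)_+\rho_k,\qquad h_{ij,kl}=\frac{f_{ik}+f_{jl}-f_{il}-f_{jk}}{\Delta x^2},$$ where the $f$'s are evaluated at $\rho$ and $D=\{\Phi\in\mathbb R^n:\sum_{(i,j)\in E}(\frac{\Phi_i-\Phi_j}{\Delta x})_+^2\rho_i=1\}$. Suppose that $W$ is positive semidefinite. Then for every $\rho^0\in\mathcal P_o(G)$, (a1) has a unique solution $\rho:[0,\infty)\to\mathcal P_o(G)$ with $\rho(0)=\rho^0$. There is exactly one Gibbs measure $\rho^\infty$. It is a global attractor of (a1): it lies in $\mathcal P_o(G)$,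 it is a Lyapunov stable equilibrium, and $\rho(t)\to\rho^\infty$ as $t\to\infty$ for every solution, uniformly in the initial condition $\rho^0\in\mathcal P_o(G)$. There is a constant $C>0$ such that for every solution and every $t\ge0$ $$\mathcal F(\rho(t))-\mathcal F(\rho^\infty)\le e^{-Ct}\big(\mathcal F(\rho^0)-\mathcal F(\rho^\infty)\big).$$ Moreover the minimum $\lambda_{\mathcal F}(\rho^\infty)$ is attained and positive, and the asymptotic convergence rate is $2\lambda_{\mathcal F}(\rho^\infty)$: for every solution $\rho$ and every $\varepsilon>0$ there is $T>0$ such that for all $t\ge T$ $$\mathcal F(\rho(t))-\mathcal F(\rho^\infty)\le e^{-2(\lambda_{\mathcal F}(\rho^\infty)-\varepsilon)(t-T)}\big(\mathcal F(\rho(T))-\mathcal F(\rho^\infty)\big).$$ -/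

import Mathlib

open Set Filter Topology

noncomputable section

namespace GraphFlow

variable {V : Type*} [Fintype V] [DecidableEq V]

/-- The set `P_o(G)` of strictly positive probability vectors on the vertices. -/
def posSimplex (V : Type*) [Fintype V] : Set (V → ℝ) :=
  {ρ | (∀ i, 0 < ρ i) ∧ ∑ i, ρ i = 1}

/-- The discrete free energy: linear potential, interaction and entropy. -/
def freeEnergy (v : V → ℝ) (W : Matrix V V ℝ) (β : ℝ) (ρ : V → ℝ) : ℝ :=
  ∑ i, v i * ρ i + (1 / 2) * ∑ i, ∑ j, W i j * ρ i * ρ j + β * ∑ i, ρ i * Real.log (ρ i)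

/-- The partial derivative `∂f/∂ρ_i` of a function on `ℝ^V`. -/
def partialDeriv (f : (V → ℝ) → ℝ) (i : V) (ρ : V → ℝ) : ℝ :=
  lineDeriv ℝ f ρ (Pi.single i 1)

/-- `F_i(ρ) = ∂𝓕/∂ρ_i (ρ)`. -/
def firstVar (v : V → ℝ) (W : Matrix V V ℝ) (β : ℝ) (i : V) (ρ : V → ℝ) : ℝ :=
  partialDeriv (freeEnergy v W β) i ρ

/-- `f_ij(ρ) = ∂²𝓕/∂ρ_i∂ρ_j (ρ)`. -/
def secondVar (v : V → ℝ) (W : Matrix V V ℝ) (β : ℝ) (i j : V) (ρ : V → ℝ) : ℝ :=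
  partialDeriv (partialDeriv (freeEnergy v W β) j) i ρ

/-- The right-hand side of the semi-discretization scheme with mesh size `Δx`. -/
def schemeRHS (G : SimpleGraph V) [DecidableRel G.Adj] (v : V → ℝ) (W : Matrix V V ℝ)
    (β Δx : ℝ) (ρ : V → ℝ) : V → ℝ := fun i =>
  1 / Δx ^ 2 *
    (∑ j ∈ G.neighborFinset i, ρ j * max (firstVar v W β j ρ - firstVar v W β i ρ) 0
      - ∑ j ∈ G.neighborFinset i, ρ i * max (firstVar v W β i ρ - firstVar v W β j ρ) 0)

/-- `ρ : [0, ∞) → P_o(G)` solves the scheme (only the values at times `t ≥ 0` matter; the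
derivative is one-sided at `t = 0`). -/
def IsSolution (G : SimpleGraph V) [DecidableRel G.Adj] (v : V → ℝ) (W : Matrix V V ℝ)
    (β Δx : ℝ) (ρ : ℝ → V → ℝ) : Prop :=
  ∀ t, 0 ≤ t → ρ t ∈ posSimplex V ∧
    HasDerivWithinAt ρ (schemeRHS G v W β Δx (ρ t)) (Ici 0) t

/-- A discrete Gibbs measure: a probability vector with
`ρ_i = K⁻¹ exp (-(v_i + ∑_j w_ij ρ_j) / β)`, `K` being the normalizing constant. -/
def IsGibbs (v : V → ℝ) (W : Matrix V V ℝ) (β : ℝ) (ρ : V → ℝ) : Prop :=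
  ρ ∈ stdSimplex ℝ V ∧
    ∀ i, ρ i = Real.exp (-(v i + ∑ j, W i j * ρ j) / β) /
      ∑ k, Real.exp (-(v k + ∑ j, W k j * ρ j) / β)

/-- The point `p` is a global attractor of the scheme on the phase space `P_o(G)`: it is an
equilibrium, it is Lyapunov stable, every solution converges to it, and the convergence is uniform
over all initial data (the whole phase space is bounded, so this says that bounded sets of initial
data are attracted). -/
structure IsGlobalAttractor (G : SimpleGraph V) [DecidableRel G.Adj] (v : V → ℝ)
    (W : Matrix V V ℝ) (β Δx : ℝ) (p : V → ℝ) : Prop where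
  mem : p ∈ posSimplex V
  equilibrium : schemeRHS G v W β Δx p = 0
  stable : ∀ ε > 0, ∃ δ > 0, ∀ ρ : ℝ → V → ℝ, IsSolution G v W β Δx ρ →
    dist (ρ 0) p < δ → ∀ t, 0 ≤ t → dist (ρ t) p < ε
  converges : ∀ ρ : ℝ → V → ℝ, IsSolution G v W β Δx ρ → Tendsto ρ atTop (𝓝 p)
  uniform : ∀ ε > 0, ∃ T > 0, ∀ ρ : ℝ → V → ℝ, IsSolution G v W β Δx ρ →
    ∀ t, T ≤ t → dist (ρ t) p < ε

/-- `h_{ij,kl} = (f_ik + f_jl - f_il - f_jk) / Δx²`. -/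
def hCoeff (v : V → ℝ) (W : Matrix V V ℝ) (β Δx : ℝ) (ρ : V → ℝ) (i j k l : V) : ℝ :=
  (secondVar v W β i k ρ + secondVar v W β j l ρ - secondVar v W β i l ρ
    - secondVar v W β j k ρ) / Δx ^ 2

/-- The objective whose minimum is `λ_𝓕(ρ)`. The sums over edges are over ordered pairs. -/
def rateForm (G : SimpleGraph V) [DecidableRel G.Adj] (v : V → ℝ) (W : Matrix V V ℝ)
    (β Δx : ℝ) (ρ Φ : V → ℝ) : ℝ :=
  ∑ i, ∑ j ∈ G.neighborFinset i, ∑ k, ∑ l ∈ G.neighborFinset k,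
    hCoeff v W β Δx ρ i j k l * max ((Φ i - Φ j) / Δx) 0 * ρ i
      * max ((Φ k - Φ l) / Δx) 0 * ρ k

/-- The constraint set `D` of potentials. -/
def rateDomain (G : SimpleGraph V) [DecidableRel G.Adj] (Δx : ℝ) (ρ : V → ℝ) : Set (V → ℝ) :=
  {Φ | ∑ i, ∑ j ∈ G.neighborFinset i, max ((Φ i - Φ j) / Δx) 0 ^ 2 * ρ i = 1}

/-- `lam` is the dissipation rate `λ_𝓕(ρ)`, the minimum of `rateForm` on `rateDomain`. -/
def IsRate (G : SimpleGraph V) [DecidableRel G.Adj] (v : V → ℝ) (W : Matrix V V ℝ)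
    (β Δx : ℝ) (ρ : V → ℝ) (lam : ℝ) : Prop :=
  IsLeast (rateForm G v W β Δx ρ '' rateDomain G Δx ρ) lam

end GraphFlow

end

/-!
Write `F = 𝓕(p)` at a Gibbs measure `p`. On the open simplex the scheme is
`ρ' = -Δx⁻² · flux ρ (∇𝓕(ρ))`, and pairing the flux of `Φ` with `Φ` itself gives the upwind
Dirichlet energy; hence `d/dt 𝓕(ρ) = -Δx⁻² · dirichlet ρ (∇𝓕(ρ))`, and every decay estimate is a
lower bound for the Dirichlet energy followed by Grönwall's inequality.

* Globally, a small Dirichlet energy keeps `ρ` away from the boundary: the potential contains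
  `β log ρ_i`, so along a path starting at a vertex of mass at least `1 / n` the mass cannot drop
  faster than geometrically. There, convexity gives `𝓕(ρ) - F ≤ K · dirichlet`.
* Near `p` the Dirichlet energy is, to second order, that of `H δ` where `H` is the Hessian of `𝓕`
  at `p` and `δ = ρ - p`. The rate `λ` is the best constant in
  `λ Δx² · dirichlet p Φ ≤ ⟨flux p Φ, H flux p Φ⟩`. Duality between the flux and the Dirichlet
  energy turns this into `λ Δx² ⟨δ, H δ⟩ ≤ dirichlet p (H δ)`, and `𝓕(ρ) - F` is `⟨δ, H δ⟩ / 2`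
  to second order.

Solutions exist globally because at a vertex of minimal mass the logarithmic terms only push mass
in, so the minimum decays at most exponentially and the solution stays in a compact part of the
open simplex, where the field is Lipschitz.
-/

noncomputable section

namespace GraphFlow

open Matrix

lemma hasDerivAt_add_smul {E : Type*} [NormedAddCommGroup E] [NormedSpace ℝ E] (x e : E) :
    HasDerivAt (fun t : ℝ => x + t • e) e 0 := by
  simpa using ((hasDerivAt_id (0 : ℝ)).smul_const e).const_add x

lemma eventually_pos_of_continuousAt {ι X : Type*} [Finite ι] [TopologicalSpace X]
    {γ : X → ι → ℝ} {x : X} (hγ : ContinuousAt γ x) (hpos : ∀ i, 0 < γ x i) :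
    ∀ᶠ y in 𝓝 x, ∀ i, 0 < γ y i :=
  eventually_all.2 fun i => (continuousAt_pi.1 hγ i).eventually_const_lt (hpos i)

lemma sub_length_mul_le_of_walk {V : Type*} {G : SimpleGraph V} {f : V → ℝ} {L M : ℝ}
    (hM : 0 ≤ M) (hstep : ∀ i j, G.Adj i j → L ≤ f i → f i - M ≤ f j) {u w : V}
    (p : G.Walk u w) (hL : L ≤ f u - p.length * M) : f u - p.length * M ≤ f w := by
  induction p with
  | nil => simp
  | @cons u x w h p ih =>
    rw [SimpleGraph.Walk.length_cons, Nat.cast_add_one, add_mul, one_mul] at hL ⊢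
    have hlen : 0 ≤ p.length * M := by positivity
    have hx := hstep u x h (by linarith)
    linarith [ih (by linarith)]

variable {V : Type*} [Fintype V] {v : V → ℝ} {W : Matrix V V ℝ} {α β : ℝ}

section FirstVariation

/-- The first variation `F_i(ρ)` in closed form; `firstVar` agrees with it at positive densities. -/
def potential (v : V → ℝ) (W : Matrix V V ℝ) (β : ℝ) (ρ : V → ℝ) : V → ℝ := fun i =>
  v i + (W *ᵥ ρ) i + β * (Real.log (ρ i) + 1)

lemma dotProduct_mulVec_comm (hW : W.IsSymm) (x y : V → ℝ) :
    x ⬝ᵥ W *ᵥ y = y ⬝ᵥ W *ᵥ x := by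
  rw [← dotProduct_transpose_mulVec, hW.eq]

lemma freeEnergy_eq (v : V → ℝ) (W : Matrix V V ℝ) (β : ℝ) (ρ : V → ℝ) :
    freeEnergy v W β ρ =
      v ⬝ᵥ ρ + 1 / 2 * (ρ ⬝ᵥ W *ᵥ ρ) + β * ∑ i, ρ i * Real.log (ρ i) := by
  simp only [freeEnergy, dotProduct, mulVec, Finset.mul_sum, mul_left_comm (ρ _), mul_assoc]

lemma continuous_freeEnergy (v : V → ℝ) (W : Matrix V V ℝ) (β : ℝ) :
    Continuous (freeEnergy v W β) := by
  have := Real.continuous_mul_log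
  unfold freeEnergy
  fun_prop

lemma hasDerivWithinAt_mulVec {γ : ℝ → V → ℝ} {γ' : V → ℝ} {s : Set ℝ} {t : ℝ}
    (W : Matrix V V ℝ) (hγ : HasDerivWithinAt γ γ' s t) :
    HasDerivWithinAt (fun u => W *ᵥ γ u) (W *ᵥ γ') s t :=
  (mulVecLin W).toContinuousLinearMap.hasFDerivAt.comp_hasDerivWithinAt t hγ

lemma hasDerivWithinAt_dotProduct {γ η : ℝ → V → ℝ} {γ' η' : V → ℝ} {s : Set ℝ} {t : ℝ}
    (hγ : HasDerivWithinAt γ γ' s t) (hη : HasDerivWithinAt η η' s t) :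
    HasDerivWithinAt (fun u => γ u ⬝ᵥ η u) (γ' ⬝ᵥ η t + γ t ⬝ᵥ η') s t := by
  refine (HasDerivWithinAt.fun_sum fun i _ =>
    (hasDerivWithinAt_pi.1 hγ i).mul (hasDerivWithinAt_pi.1 hη i)).congr_deriv ?_
  exact Finset.sum_add_distrib

lemma hasDerivWithinAt_freeEnergy (hW : W.IsSymm) {γ : ℝ → V → ℝ} {γ' : V → ℝ} {s : Set ℝ}
    {t : ℝ} (hγ : HasDerivWithinAt γ γ' s t) (hpos : ∀ i, 0 < γ t i) :
    HasDerivWithinAt (fun u => freeEnergy v W β (γ u)) (potential v W β (γ t) ⬝ᵥ γ') s t := by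
  have hlin := hasDerivWithinAt_dotProduct (hasDerivWithinAt_const t s v) hγ
  have hquad := hasDerivWithinAt_dotProduct hγ (hasDerivWithinAt_mulVec W hγ)
  have hent : HasDerivWithinAt (fun u => ∑ i, γ u i * Real.log (γ u i))
      (∑ i, (Real.log (γ t i) + 1) * γ' i) s t :=
    HasDerivWithinAt.fun_sum fun i _ => (Real.hasDerivAt_mul_log (hpos i).ne').comp_hasDerivWithinAt
      (h := fun u => γ u i) t (hasDerivWithinAt_pi.1 hγ i)
  simp only [freeEnergy_eq]
  refine ((hlin.add (hquad.const_mul (1 / 2))).add (hent.const_mul β)).congr_deriv ?_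
  have hpot : potential v W β (γ t) = v + W *ᵥ γ t + β • fun i => Real.log (γ t i) + 1 := rfl
  rw [hpot, add_dotProduct, add_dotProduct, smul_dotProduct, dotProduct_comm (W *ᵥ γ t),
    dotProduct_mulVec_comm hW (γ t) γ', zero_dotProduct, smul_eq_mul]
  simp only [dotProduct]
  ring

variable [DecidableEq V]

/-- The Hessian of the free energy in closed form; `secondVar` agrees with it at positive
densities. -/
def hessian (W : Matrix V V ℝ) (β : ℝ) (ρ : V → ℝ) : Matrix V V ℝ :=
  W + diagonal fun i => β / ρ i

lemma hessian_mulVec (W : Matrix V V ℝ) (β : ℝ) (ρ x : V → ℝ) :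
    hessian W β ρ *ᵥ x = W *ᵥ x + fun i => β / ρ i * x i := by
  ext i
  simp [hessian, add_mulVec, mulVec_diagonal]

lemma hasDerivWithinAt_potential {γ : ℝ → V → ℝ} {γ' : V → ℝ} {s : Set ℝ} {t : ℝ}
    (hγ : HasDerivWithinAt γ γ' s t) (hpos : ∀ i, 0 < γ t i) :
    HasDerivWithinAt (fun u => potential v W β (γ u)) (hessian W β (γ t) *ᵥ γ') s t := by
  refine hasDerivWithinAt_pi.2 fun i => ?_
  have hlog := (((hasDerivWithinAt_pi.1 hγ i).log (hpos i).ne').add_const 1).const_mul β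
  refine (((hasDerivWithinAt_pi.1 (hasDerivWithinAt_mulVec W hγ) i).const_add (v i)).add
    hlog).congr_deriv ?_
  rw [hessian_mulVec, Pi.add_apply]
  ring

lemma firstVar_eq (hW : W.IsSymm) {ρ : V → ℝ} (hρ : ∀ i, 0 < ρ i) (i : V) :
    firstVar v W β i ρ = potential v W β ρ i := by
  have := hasDerivWithinAt_freeEnergy (v := v) (β := β) hW
    (hasDerivAt_add_smul ρ (Pi.single i 1)).hasDerivWithinAt (s := univ) (by simpa using hρ)
  simpa [firstVar, partialDeriv, lineDeriv] using (hasDerivWithinAt_univ.1 this).deriv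

lemma secondVar_eq (hW : W.IsSymm) {ρ : V → ℝ} (hρ : ∀ i, 0 < ρ i) (i j : V) :
    secondVar v W β i j ρ = hessian W β ρ i j := by
  have hline := hasDerivAt_add_smul ρ (Pi.single i (1 : ℝ))
  have hfirst : (fun t : ℝ => firstVar v W β j (ρ + t • Pi.single i (1 : ℝ))) =ᶠ[𝓝 0]
      fun t => potential v W β (ρ + t • Pi.single i (1 : ℝ)) j :=
    (eventually_pos_of_continuousAt hline.continuousAt
      (by simpa using hρ)).mono fun t ht => firstVar_eq hW ht j
  have hpot := hasDerivWithinAt_pi.1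
    (hasDerivWithinAt_potential (v := v) (W := W) (β := β) hline.hasDerivWithinAt
      (s := univ) (by simpa using hρ)) j
  have : secondVar v W β i j ρ = deriv (fun t : ℝ => firstVar v W β j (ρ + t • Pi.single i 1)) 0 :=
    rfl
  rw [this, hfirst.deriv_eq, (hasDerivWithinAt_univ.1 hpot).deriv]
  simpa [hessian] using (hW.add (isSymm_diagonal fun i => β / ρ i)).apply i j

end FirstVariation

section Flux

variable (G : SimpleGraph V) [DecidableRel G.Adj]

/-- The upwind net outflow `∑ⱼ ρ_i (Φ_i - Φ_j)₊ - ∑ⱼ ρ_j (Φ_j - Φ_i)₊` driven by `Φ`: minus the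
weighted divergence on the graph. -/
def flux (ρ Φ : V → ℝ) : V → ℝ := fun i =>
  ∑ j ∈ G.neighborFinset i, ρ i * max (Φ i - Φ j) 0
    - ∑ j ∈ G.neighborFinset i, ρ j * max (Φ j - Φ i) 0

/-- The upwind Dirichlet energy `∑_{(i,j) ∈ E} ρ_i (Φ_i - Φ_j)₊²`. -/
def dirichlet (ρ Φ : V → ℝ) : ℝ :=
  ∑ i, ∑ j ∈ G.neighborFinset i, ρ i * max (Φ i - Φ j) 0 ^ 2

lemma schemeRHS_eq [DecidableEq V] (hW : W.IsSymm) (Δx : ℝ) {ρ : V → ℝ} (hρ : ∀ i, 0 < ρ i) :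
    schemeRHS G v W β Δx ρ = -(1 / Δx ^ 2) • flux G ρ (potential v W β ρ) := by
  ext i
  simp only [schemeRHS, flux, firstVar_eq hW hρ, Pi.smul_apply, smul_eq_mul]
  ring

lemma sum_sum_neighborFinset_comm {M : Type*} [AddCommMonoid M] (f : V → V → M) :
    ∑ i, ∑ j ∈ G.neighborFinset i, f i j = ∑ i, ∑ j ∈ G.neighborFinset i, f j i :=
  Finset.sum_comm' fun i j => by simp [G.adj_comm]

lemma dotProduct_flux (ρ Φ g : V → ℝ) :
    g ⬝ᵥ flux G ρ Φ =
      ∑ i, ∑ j ∈ G.neighborFinset i, ρ i * max (Φ i - Φ j) 0 * (g i - g j) := by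
  simp only [flux, dotProduct, mul_sub, Finset.sum_sub_distrib, Finset.mul_sum]
  rw [sum_sum_neighborFinset_comm G fun i j => g i * (ρ j * max (Φ j - Φ i) 0)]
  simp only [mul_comm (g _)]

lemma sum_flux (ρ Φ : V → ℝ) : ∑ i, flux G ρ Φ i = 0 := by
  simpa [dotProduct] using dotProduct_flux G ρ Φ fun _ => 1

lemma dotProduct_flux_self (ρ Φ : V → ℝ) : Φ ⬝ᵥ flux G ρ Φ = dirichlet G ρ Φ := by
  have hsq (x : ℝ) : max x 0 * x = max x 0 ^ 2 := by
    rcases le_total x 0 with h | h <;> simp [h, sq]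
  rw [dotProduct_flux]
  simp only [mul_assoc, hsq, dirichlet]

lemma continuous_flux : Continuous fun x : (V → ℝ) × (V → ℝ) => flux G x.1 x.2 := by
  unfold flux
  fun_prop

lemma continuous_dirichlet : Continuous fun x : (V → ℝ) × (V → ℝ) => dirichlet G x.1 x.2 := by
  unfold dirichlet
  fun_prop

lemma dirichlet_nonneg {ρ : V → ℝ} (hρ : ∀ i, 0 ≤ ρ i) (Φ : V → ℝ) : 0 ≤ dirichlet G ρ Φ :=
  Finset.sum_nonneg fun i _ => Finset.sum_nonneg fun _ _ => mul_nonneg (hρ i) (sq_nonneg _)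

lemma flux_smul (ρ Φ : V → ℝ) {s : ℝ} (hs : 0 ≤ s) : flux G ρ (s • Φ) = s • flux G ρ Φ := by
  have hmax (i j : V) : max (s * Φ i - s * Φ j) 0 = s * max (Φ i - Φ j) 0 := by
    rw [mul_max_of_nonneg _ _ hs, mul_sub, mul_zero]
  ext i
  simp only [flux, Pi.smul_apply, smul_eq_mul, hmax, mul_sub, Finset.mul_sum, mul_left_comm]

lemma dirichlet_smul (ρ Φ : V → ℝ) {s : ℝ} (hs : 0 ≤ s) :
    dirichlet G ρ (s • Φ) = s ^ 2 * dirichlet G ρ Φ := by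
  rw [← dotProduct_flux_self, flux_smul G ρ Φ hs, smul_dotProduct, dotProduct_smul,
    dotProduct_flux_self, smul_eq_mul, smul_eq_mul, sq, mul_assoc]

lemma flux_sub_const (ρ Φ : V → ℝ) (c : ℝ) : flux G ρ (fun i => Φ i - c) = flux G ρ Φ := by
  ext i
  simp [flux]

lemma dirichlet_sub_const (ρ Φ : V → ℝ) (c : ℝ) :
    dirichlet G ρ (fun i => Φ i - c) = dirichlet G ρ Φ := by
  simp [dirichlet]

variable {G}

lemma mul_max_sq_le_dirichlet {ρ : V → ℝ} (hρ : ∀ i, 0 ≤ ρ i) (Φ : V → ℝ) {i j : V}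
    (h : G.Adj i j) : ρ i * max (Φ i - Φ j) 0 ^ 2 ≤ dirichlet G ρ Φ := by
  have hnonneg (i j : V) : 0 ≤ ρ i * max (Φ i - Φ j) 0 ^ 2 := mul_nonneg (hρ i) (sq_nonneg _)
  calc ρ i * max (Φ i - Φ j) 0 ^ 2
      ≤ ∑ j ∈ G.neighborFinset i, ρ i * max (Φ i - Φ j) 0 ^ 2 :=
        Finset.single_le_sum (f := fun j => ρ i * max (Φ i - Φ j) 0 ^ 2)
          (fun j _ => hnonneg i j) (by simpa using h)
    _ ≤ dirichlet G ρ Φ := Finset.single_le_sum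
        (f := fun i => ∑ j ∈ G.neighborFinset i, ρ i * max (Φ i - Φ j) 0 ^ 2)
        (fun i _ => Finset.sum_nonneg fun j _ => hnonneg i j) (Finset.mem_univ i)

end Flux

section Connected

variable {G : SimpleGraph V}

lemma sub_card_mul_le_of_connected (hG : G.Connected) {f : V → ℝ} {M : ℝ} (hM : 0 ≤ M) (u w : V)
    (hstep : ∀ i j, G.Adj i j → f u - Fintype.card V * M ≤ f i → f i - M ≤ f j) :
    f u - Fintype.card V * M ≤ f w := by
  classical
  obtain ⟨p, hp⟩ := (hG.preconnected u w).exists_isPath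
  have hlen : f u - Fintype.card V * M ≤ f u - p.length * M := by
    gcongr
    exact hp.length_lt.le
  exact hlen.trans (sub_length_mul_le_of_walk hM hstep p hlen)

lemma mul_sq_sub_le_dirichlet [DecidableRel G.Adj] (hG : G.Connected) {ρ : V → ℝ} {ε : ℝ}
    (hε : 0 < ε) (hρ : ∀ i, ε ≤ ρ i) (Φ : V → ℝ) (u w : V) :
    ε * (Φ u - Φ w) ^ 2 ≤ Fintype.card V ^ 2 * dirichlet G ρ Φ := by
  have hρ0 (i : V) : 0 ≤ ρ i := hε.le.trans (hρ i)
  have hD := dirichlet_nonneg G hρ0 Φ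
  set M := √(dirichlet G ρ Φ / ε)
  have hM : M ^ 2 = dirichlet G ρ Φ / ε := Real.sq_sqrt (by positivity)
  have hstep (i j : V) (h : G.Adj i j) : Φ i - M ≤ Φ j := by
    have hij : max (Φ i - Φ j) 0 ^ 2 ≤ dirichlet G ρ Φ / ε := by
      rw [le_div_iff₀' hε]
      exact (mul_le_mul_of_nonneg_right (hρ i) (sq_nonneg _)).trans
        (mul_max_sq_le_dirichlet hρ0 Φ h)
    linarith [le_max_left (Φ i - Φ j) 0, Real.le_sqrt_of_sq_le hij]
  have habs : |Φ u - Φ w| ≤ Fintype.card V * M := by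
    have huw (u w : V) := sub_card_mul_le_of_connected hG (f := Φ) (Real.sqrt_nonneg _) u w
      fun i j h _ => hstep i j h
    exact abs_sub_le_iff.2 ⟨by linarith [huw u w], by linarith [huw w u]⟩
  calc ε * (Φ u - Φ w) ^ 2 = ε * |Φ u - Φ w| ^ 2 := by rw [sq_abs]
    _ ≤ ε * (Fintype.card V * M) ^ 2 := by gcongr
    _ = Fintype.card V ^ 2 * dirichlet G ρ Φ := by rw [mul_pow, hM]; field_simp

end Connected

section Convexity

/-- The quadratic form `W + β` dominates `α` on vectors of total mass zero. As densities are at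
most `1`, the free energy is then `α`-convex on the simplex. -/
def IsConvexityModulus (W : Matrix V V ℝ) (β α : ℝ) : Prop :=
  ∀ x : V → ℝ, ∑ i, x i = 0 → α * (x ⬝ᵥ x) ≤ x ⬝ᵥ W *ᵥ x + β * (x ⬝ᵥ x)

lemma isConvexityModulus_of_posSemidef (hW : W.PosSemidef) (β : ℝ) : IsConvexityModulus W β β :=
  fun x _ => le_add_of_nonneg_left (by simpa using hW.dotProduct_mulVec_nonneg x)

/-- The relative entropy of `σ` with respect to `ρ`, which measures the gap in the convexity of the
entropy. The terms `ρ i - σ i` make every summand nonnegative. -/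
def relEntropy (σ ρ : V → ℝ) : ℝ :=
  ∑ i, (σ i * Real.log (σ i / ρ i) - σ i + ρ i)

lemma posSimplex_subset_stdSimplex : posSimplex V ⊆ stdSimplex ℝ V :=
  fun _ hρ => ⟨fun i => (hρ.1 i).le, hρ.2⟩

lemma le_one_of_mem_stdSimplex {ρ : V → ℝ} (hρ : ρ ∈ stdSimplex ℝ V) (i : V) : ρ i ≤ 1 :=
  hρ.2 ▸ Finset.single_le_sum (fun j _ => hρ.1 j) (Finset.mem_univ i)

lemma sum_sub_eq_zero {σ ρ : V → ℝ} (hσ : σ ∈ stdSimplex ℝ V) (hρ : ρ ∈ stdSimplex ℝ V) :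
    ∑ i, (σ - ρ) i = 0 := by
  simp only [Pi.sub_apply, Finset.sum_sub_distrib, hσ.2, hρ.2, sub_self]

lemma convexOn_mul_log_sub_sq_div_two :
    ConvexOn ℝ (Icc 0 1) fun x => x * Real.log x - x ^ 2 / 2 := by
  refine convexOn_of_hasDerivWithinAt2_nonneg (convex_Icc 0 1)
    (f' := fun x => Real.log x + 1 - x) (f'' := fun x => x⁻¹ - 1)
    (Real.continuous_mul_log.sub (by fun_prop)).continuousOn ?_ ?_ ?_
    <;> rw [interior_Icc] <;> intro x hx
  · have hsq : HasDerivAt (fun x : ℝ => x ^ 2 / 2) x x := by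
      simpa using (hasDerivAt_pow 2 x).div_const 2
    exact ((Real.hasDerivAt_mul_log hx.1.ne').sub hsq).hasDerivWithinAt
  · exact (((Real.hasDerivAt_log hx.1.ne').add_const 1).sub (hasDerivAt_id x)).hasDerivWithinAt
  · exact sub_nonneg.2 (one_le_inv₀ hx.1 |>.2 hx.2.le)

lemma add_mul_sub_le_of_convexOn {S : Set ℝ} {f : ℝ → ℝ} {f' x y : ℝ} (hf : ConvexOn ℝ S f)
    (hx : x ∈ S) (hy : y ∈ S) (hf' : HasDerivAt f f' y) : f y + f' * (x - y) ≤ f x := by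
  rcases lt_trichotomy x y with hxy | rfl | hxy
  · have := hf.slope_le_of_hasDerivAt hx hy hxy hf'
    rw [slope_def_field, div_le_iff₀ (sub_pos.2 hxy)] at this
    linarith
  · simp
  · have := hf.le_slope_of_hasDerivAt hy hx hxy hf'
    rw [slope_def_field, le_div_iff₀ (sub_pos.2 hxy)] at this
    linarith

lemma mul_log_div {x y : ℝ} (hy : y ≠ 0) :
    x * Real.log (x / y) = x * Real.log x - x * Real.log y := by
  rcases eq_or_ne x 0 with rfl | hx
  · simp
  · rw [Real.log_div hx hy, mul_sub]

lemma sq_sub_div_two_le_mul_log_div {x y : ℝ} (hx : x ∈ Icc 0 1) (hy : y ∈ Ioc 0 1) :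
    (x - y) ^ 2 / 2 ≤ x * Real.log (x / y) - x + y := by
  have hderiv : HasDerivAt (fun x => x * Real.log x - x ^ 2 / 2) (Real.log y + 1 - y) y :=
    (Real.hasDerivAt_mul_log hy.1.ne').sub (by simpa using (hasDerivAt_pow 2 y).div_const 2)
  have := add_mul_sub_le_of_convexOn convexOn_mul_log_sub_sq_div_two hx
    (Ioc_subset_Icc_self hy) hderiv
  rw [mul_log_div hy.1.ne']
  linarith

lemma dotProduct_sub_self_div_two_le_relEntropy {σ ρ : V → ℝ} (hσ : σ ∈ stdSimplex ℝ V)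
    (hρ : ρ ∈ posSimplex V) : (σ - ρ) ⬝ᵥ (σ - ρ) / 2 ≤ relEntropy σ ρ := by
  rw [dotProduct, Finset.sum_div]
  refine Finset.sum_le_sum fun i _ => ?_
  rw [Pi.sub_apply, ← sq]
  exact sq_sub_div_two_le_mul_log_div ⟨hσ.1 i, le_one_of_mem_stdSimplex hσ i⟩
    ⟨hρ.1 i, le_one_of_mem_stdSimplex (posSimplex_subset_stdSimplex hρ) i⟩

lemma freeEnergy_sub (hW : W.IsSymm) (v : V → ℝ) (β : ℝ) (σ : V → ℝ) {ρ : V → ℝ}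
    (hρ : ∀ i, 0 < ρ i) :
    freeEnergy v W β σ - freeEnergy v W β ρ = potential v W β ρ ⬝ᵥ (σ - ρ)
      + 1 / 2 * ((σ - ρ) ⬝ᵥ W *ᵥ (σ - ρ)) + β * relEntropy σ ρ := by
  have hpot : potential v W β ρ = v + W *ᵥ ρ + β • fun i => Real.log (ρ i) + 1 := rfl
  have hent : relEntropy σ ρ = ∑ i, σ i * Real.log (σ i) - ∑ i, ρ i * Real.log (ρ i)
      - (fun i => Real.log (ρ i) + 1) ⬝ᵥ (σ - ρ) := by
    simp only [relEntropy, dotProduct, mul_log_div (hρ _).ne', ← Finset.sum_sub_distrib]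
    exact Finset.sum_congr rfl fun i _ => by rw [Pi.sub_apply]; ring
  rw [freeEnergy_eq, freeEnergy_eq, hent, hpot, add_dotProduct, add_dotProduct, smul_dotProduct,
    smul_eq_mul, mulVec_sub]
  simp only [dotProduct_sub, sub_dotProduct, dotProduct_comm (W *ᵥ ρ),
    dotProduct_mulVec_comm hW ρ σ]
  ring

lemma potential_dotProduct_sub_le (hW : W.IsSymm) (hα : IsConvexityModulus W β α) (hβ : 0 ≤ β)
    (v : V → ℝ) {σ ρ : V → ℝ} (hσ : σ ∈ stdSimplex ℝ V) (hρ : ρ ∈ posSimplex V) :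
    potential v W β ρ ⬝ᵥ (σ - ρ) + α / 2 * ((σ - ρ) ⬝ᵥ (σ - ρ)) ≤
      freeEnergy v W β σ - freeEnergy v W β ρ := by
  have hmod := hα (σ - ρ) (sum_sub_eq_zero hσ (posSimplex_subset_stdSimplex hρ))
  have hent := mul_le_mul_of_nonneg_left (dotProduct_sub_self_div_two_le_relEntropy hσ hρ) hβ
  rw [freeEnergy_sub hW v β σ hρ.1]
  linarith

end Convexity

section Gibbs

lemma dotProduct_eq_zero_of_forall_eq {Φ x : V → ℝ} (hΦ : ∀ i j, Φ i = Φ j)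
    (hx : ∑ i, x i = 0) : Φ ⬝ᵥ x = 0 := by
  rcases isEmpty_or_nonempty V with _ | ⟨⟨o⟩⟩
  · simp [dotProduct]
  · simp only [dotProduct, hΦ _ o, ← Finset.mul_sum, hx, mul_zero]

lemma isGibbs_iff (hβ : β ≠ 0) {ρ : V → ℝ} :
    IsGibbs v W β ρ ↔
      ρ ∈ posSimplex V ∧ ∀ i j, potential v W β ρ i = potential v W β ρ j := by
  set a : V → ℝ := fun i => v i + (W *ᵥ ρ) i
  have hdef : IsGibbs v W β ρ ↔ ρ ∈ stdSimplex ℝ V ∧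
    ∀ i, ρ i = Real.exp (-a i / β) / ∑ k, Real.exp (-a k / β) := Iff.rfl
  rw [hdef]
  refine ⟨fun ⟨hρ, h⟩ => ?_, fun ⟨hρ, h⟩ => ⟨posSimplex_subset_stdSimplex hρ, fun i => ?_⟩⟩
  · set K := ∑ k, Real.exp (-a k / β)
    have hK (i : V) : 0 < K := Finset.sum_pos (fun _ _ => Real.exp_pos _) ⟨i, Finset.mem_univ i⟩
    have hlog (i : V) : potential v W β ρ i = β * (1 - Real.log K) := by
      rw [potential, h i, Real.log_div (Real.exp_pos _).ne' (hK i).ne', Real.log_exp]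
      simp only [a]
      field_simp
      ring
    exact ⟨⟨fun i => h i ▸ div_pos (Real.exp_pos _) (hK i), hρ.2⟩, fun i j => by rw [hlog, hlog]⟩
  · have hexp (j : V) :
        Real.exp (-a j / β) * Real.exp (potential v W β ρ i / β - 1) = ρ j := by
      rw [← Real.exp_add, h i j, ← Real.exp_log (hρ.1 j)]
      congr 1
      simp only [potential, a]
      field_simp
      ring
    have hsum : (∑ j, Real.exp (-a j / β)) * Real.exp (potential v W β ρ i / β - 1) = 1 := by
      rw [Finset.sum_mul]
      exact (Finset.sum_congr rfl fun j _ => hexp j).trans hρ.2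
    calc ρ i = Real.exp (-a i / β) * Real.exp (potential v W β ρ i / β - 1) := (hexp i).symm
      _ = Real.exp (-a i / β) / ∑ k, Real.exp (-a k / β) := by
        rw [eq_inv_of_mul_eq_one_right hsum, ← div_eq_mul_inv]

lemma posSimplex_nonempty [Nonempty V] : (posSimplex V).Nonempty := by
  refine ⟨fun _ => (Fintype.card V : ℝ)⁻¹, fun _ => by positivity, ?_⟩
  simp

lemma IsGibbs.dotProduct_potential_sub (hβ : β ≠ 0) {p ρ : V → ℝ} (hp : IsGibbs v W β p)
    (hρ : ρ ∈ posSimplex V) : potential v W β p ⬝ᵥ (ρ - p) = 0 :=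
  dotProduct_eq_zero_of_forall_eq ((isGibbs_iff hβ).1 hp).2
    (sum_sub_eq_zero (posSimplex_subset_stdSimplex hρ) hp.1)

lemma IsGibbs.quadratic_growth (hW : W.IsSymm) (hα : IsConvexityModulus W β α) (hβ : 0 < β)
    {p ρ : V → ℝ} (hp : IsGibbs v W β p) (hρ : ρ ∈ posSimplex V) :
    α / 2 * ((ρ - p) ⬝ᵥ (ρ - p)) ≤ freeEnergy v W β ρ - freeEnergy v W β p := by
  have := potential_dotProduct_sub_le hW hα hβ.le v (posSimplex_subset_stdSimplex hρ)
    ((isGibbs_iff hβ.ne').1 hp).1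
  rwa [hp.dotProduct_potential_sub hβ.ne' hρ, zero_add] at this

lemma IsGibbs.unique (hW : W.IsSymm) (hα : IsConvexityModulus W β α) (hβ : 0 < β) (h0α : 0 < α)
    {p q : V → ℝ} (hp : IsGibbs v W β p) (hq : IsGibbs v W β q) : p = q := by
  have hpq := hq.quadratic_growth hW hα hβ ((isGibbs_iff hβ.ne').1 hp).1
  have hqp := hp.quadratic_growth hW hα hβ ((isGibbs_iff hβ.ne').1 hq).1
  have hsymm : (q - p) ⬝ᵥ (q - p) = (p - q) ⬝ᵥ (p - q) := by
    rw [← neg_sub p q, neg_dotProduct_neg]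
  have hnonneg : 0 ≤ (p - q) ⬝ᵥ (p - q) := dotProduct_self_star_nonneg (p - q)
  rw [hsymm] at hqp
  have hzero : (p - q) ⬝ᵥ (p - q) = 0 :=
    hnonneg.antisymm' (le_of_mul_le_mul_left (by linarith) h0α)
  exact sub_eq_zero.1 (dotProduct_self_eq_zero.1 hzero)

/-- Minty's characterization of a minimizer: only potentials at interior points appear, so it makes
sense before the minimizer is known to be positive. -/
lemma potential_dotProduct_sub_nonneg (hW : W.IsSymm) (hα : IsConvexityModulus W β α)
    (hβ : 0 ≤ β) (h0α : 0 ≤ α) {p σ : V → ℝ} (hp : p ∈ stdSimplex ℝ V)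
    (hmin : IsMinOn (freeEnergy v W β) (stdSimplex ℝ V) p) (hσ : σ ∈ posSimplex V) :
    0 ≤ potential v W β σ ⬝ᵥ (σ - p) := by
  have hconv := potential_dotProduct_sub_le hW hα hβ v hp hσ
  have hnonneg : 0 ≤ (p - σ) ⬝ᵥ (p - σ) := dotProduct_self_star_nonneg (p - σ)
  have hle := isMinOn_iff.1 hmin σ (posSimplex_subset_stdSimplex hσ)
  have hmod : 0 ≤ α / 2 * ((p - σ) ⬝ᵥ (p - σ)) := by positivity
  rw [← neg_sub p σ, dotProduct_neg]
  linarith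

lemma sub_mul_log_sub_log_nonpos {p u t : ℝ} (hp : 0 ≤ p) (hu : 0 < u) (ht : t ∈ Ioo 0 1) :
    (u - p) * (Real.log ((1 - t) * p + t * u) - Real.log u) ≤ 0 := by
  have hpos : 0 < (1 - t) * p + t * u := by nlinarith [ht.1, ht.2, mul_pos ht.1 hu]
  rcases le_total p u with h | h
  · refine mul_nonpos_of_nonneg_of_nonpos (sub_nonneg.2 h) (sub_nonpos.2 ?_)
    exact Real.log_le_log hpos (by nlinarith [ht.2])
  · refine mul_nonpos_of_nonpos_of_nonneg (sub_nonpos.2 h) (sub_nonneg.2 ?_)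
    exact Real.log_le_log hu (by nlinarith [ht.2])

lemma segment_mem_posSimplex {p u : V → ℝ} {t : ℝ} (hp : p ∈ stdSimplex ℝ V)
    (hu : u ∈ posSimplex V) (ht : t ∈ Ioo 0 1) : (1 - t) • p + t • u ∈ posSimplex V := by
  refine ⟨fun i => ?_, ?_⟩
  · have := mul_nonneg (sub_nonneg.2 ht.2.le) (hp.1 i)
    have := mul_pos ht.1 (hu.1 i)
    simp only [Pi.add_apply, Pi.smul_apply, smul_eq_mul]
    linarith
  · simp [Finset.sum_add_distrib, ← Finset.mul_sum, hp.2, hu.2]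

/-- Since `β u_k log t → -∞` as `t → 0`, the free energy decreases into the simplex at a vertex
without mass. -/
lemma potential_segment_dotProduct_sub_le (hβ : 0 ≤ β) {p u : V → ℝ} {t : ℝ}
    (hp : p ∈ stdSimplex ℝ V) (hu : u ∈ posSimplex V) (ht : t ∈ Ioo 0 1) {k : V} (hk : p k = 0) :
    potential v W β ((1 - t) • p + t • u) ⬝ᵥ (u - p) ≤
      (fun i => v i + (W *ᵥ ((1 - t) • p + t • u)) i + β * (Real.log (u i) + 1)) ⬝ᵥ (u - p)
        + β * (u k * Real.log t) := by
  set σ := (1 - t) • p + t • u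
  have hsum : ∑ i, (u i - p i) * (Real.log (σ i) - Real.log (u i)) ≤ u k * Real.log t := by
    classical
    rw [← Finset.add_sum_erase _ _ (Finset.mem_univ k)]
    refine add_le_of_le_of_nonpos (Eq.le ?_) (Finset.sum_nonpos fun i _ =>
      sub_mul_log_sub_log_nonpos (hp.1 i) (hu.1 i) ht)
    simp [σ, hk, Real.log_mul ht.1.ne' (hu.1 k).ne']
  refine le_trans (Eq.le ?_) (add_le_add_right (mul_le_mul_of_nonneg_left hsum hβ) _)
  simp only [dotProduct, Finset.mul_sum, ← Finset.sum_add_distrib, potential]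
  exact Finset.sum_congr rfl fun i _ => by rw [Pi.sub_apply]; ring

lemma pos_of_isMinOn_freeEnergy (hW : W.IsSymm) (hα : IsConvexityModulus W β α) (hβ : 0 < β)
    (h0α : 0 ≤ α) {p : V → ℝ} (hp : p ∈ stdSimplex ℝ V)
    (hmin : IsMinOn (freeEnergy v W β) (stdSimplex ℝ V) p) (k : V) : 0 < p k := by
  by_contra! hk
  have : Nonempty V := ⟨k⟩
  obtain ⟨u, hu⟩ := posSimplex_nonempty (V := V)
  have hcont : Continuous fun t : ℝ =>
      (fun i => v i + (W *ᵥ ((1 - t) • p + t • u)) i + β * (Real.log (u i) + 1)) ⬝ᵥ (u - p) := by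
    have : Continuous fun t : ℝ => W *ᵥ ((1 - t) • p + t • u) :=
      continuous_const.matrix_mulVec (by fun_prop)
    exact Continuous.dotProduct (by fun_prop) continuous_const
  obtain ⟨B, hB⟩ := (isCompact_Icc (a := (0 : ℝ)) (b := 1)).bddAbove_image hcont.continuousOn
  have hforce (t : ℝ) (ht : t ∈ Ioo 0 1) : 0 ≤ B + β * (u k * Real.log t) := by
    have hminty := potential_dotProduct_sub_nonneg hW hα hβ.le h0α hp hmin
      (segment_mem_posSimplex hp hu ht)
    have hdir : (1 - t) • p + t • u - p = t • (u - p) := by module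
    rw [hdir, dotProduct_smul, smul_eq_mul] at hminty
    refine (nonneg_of_mul_nonneg_right hminty ht.1).trans
      ((potential_segment_dotProduct_sub_le hβ.le hp hu ht (hk.antisymm (hp.1 k))).trans ?_)
    gcongr
    exact hB ⟨t, Ioo_subset_Icc_self ht, rfl⟩
  have hβu : 0 < β * u k := mul_pos hβ (hu.1 k)
  have := hforce (Real.exp (-((|B| + 1) / (β * u k))))
    ⟨Real.exp_pos _, Real.exp_lt_one_iff.2 (neg_lt_zero.2 (by positivity))⟩
  rw [Real.log_exp, ← mul_assoc, mul_neg, mul_div_cancel₀ _ hβu.ne'] at this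
  linarith [le_abs_self B]

lemma potential_eq_of_isMinOn (hW : W.IsSymm) {p : V → ℝ} (hp : p ∈ posSimplex V)
    (hmin : IsMinOn (freeEnergy v W β) (stdSimplex ℝ V) p) (i j : V) :
    potential v W β p i = potential v W β p j := by
  classical
  let e : V → ℝ := Pi.single i 1 - Pi.single j 1
  have hline := hasDerivAt_add_smul p e
  have hpos : ∀ᶠ t : ℝ in 𝓝 0, ∀ k, 0 < (p + t • e) k :=
    eventually_pos_of_continuousAt hline.continuousAt (by simpa using hp.1)
  have hlocal : IsLocalMin (fun t : ℝ => freeEnergy v W β (p + t • e)) 0 := by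
    filter_upwards [hpos] with t ht
    have hmass : ∑ k, (p + t • e) k = 1 := by
      simp [e, Finset.sum_add_distrib, ← Finset.mul_sum, hp.2]
    simpa using isMinOn_iff.1 hmin _ ⟨fun k => (ht k).le, hmass⟩
  have hderiv := hasDerivWithinAt_freeEnergy (v := v) (β := β) hW
    (hline.hasDerivWithinAt (s := univ)) (by simpa using hp.1)
  have hzero := hlocal.hasDerivAt_eq_zero (hasDerivWithinAt_univ.1 hderiv)
  simpa [e, dotProduct_sub, sub_eq_zero] using hzero

lemma exists_isGibbs [Nonempty V] (hW : W.IsSymm) (hα : IsConvexityModulus W β α) (hβ : 0 < β)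
    (h0α : 0 ≤ α) (v : V → ℝ) : ∃ p, IsGibbs v W β p := by
  obtain ⟨p, hp, hmin⟩ := (isCompact_stdSimplex ℝ V).exists_isMinOn
    (posSimplex_nonempty.mono posSimplex_subset_stdSimplex)
    (continuous_freeEnergy v W β).continuousOn
  have hpos : p ∈ posSimplex V := ⟨pos_of_isMinOn_freeEnergy hW hα hβ h0α hp hmin, hp.2⟩
  exact ⟨p, (isGibbs_iff hβ.ne').2 ⟨hpos, potential_eq_of_isMinOn hW hpos hmin⟩⟩

end Gibbs

section EntropyDissipation

variable {G : SimpleGraph V} [DecidableRel G.Adj]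

lemma exists_inv_card_le {ρ : V → ℝ} (hρ : ρ ∈ stdSimplex ℝ V) :
    ∃ i, (Fintype.card V : ℝ)⁻¹ ≤ ρ i := by
  by_contra! h
  have hne : Nonempty V := by
    by_contra! hV
    simpa using hρ.2
  have := Finset.sum_lt_sum_of_nonempty Finset.univ_nonempty fun i _ => h i
  simp [hρ.2] at this

lemma exists_abs_potential_sub_le (v : V → ℝ) (W : Matrix V V ℝ) (β : ℝ) :
    ∃ B ≥ 0, ∀ ρ ∈ stdSimplex ℝ V, ∀ i, |potential v W β ρ i - β * (Real.log (ρ i) + 1)| ≤ B := by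
  have hcont : Continuous fun ρ : V → ℝ => v + W *ᵥ ρ :=
    continuous_const.add (continuous_const.matrix_mulVec continuous_id)
  obtain ⟨B, hB⟩ := (isCompact_stdSimplex ℝ V).exists_bound_of_continuousOn hcont.continuousOn
  refine ⟨|B|, abs_nonneg B, fun ρ hρ i => ?_⟩
  rw [potential, add_sub_cancel_right]
  exact (norm_le_pi_norm _ i).trans ((hB ρ hρ).trans (le_abs_self B))

lemma exists_le_of_dirichlet_lt (hG : G.Connected) (v : V → ℝ) (W : Matrix V V ℝ) (hβ : 0 < β) :
    ∃ ε > 0, ∀ ρ ∈ posSimplex V, dirichlet G ρ (potential v W β ρ) < ε → ∀ i, ε ≤ ρ i := by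
  obtain ⟨B, hB₀, hB⟩ := exists_abs_potential_sub_le v W β
  set n : ℝ := (Fintype.card V : ℝ)
  set M : ℝ := (1 + 2 * B) / β
  refine ⟨Real.exp (Real.log n⁻¹ - n * M), Real.exp_pos _, fun ρ hρ hD i => ?_⟩
  have hbound := hB ρ (posSimplex_subset_stdSimplex hρ)
  have hstep (i j : V) (hij : G.Adj i j)
      (hi : Real.exp (Real.log n⁻¹ - n * M) ≤ ρ i) : Real.log (ρ i) - M ≤ Real.log (ρ j) := by
    set x := potential v W β ρ i - potential v W β ρ j
    have hx : x < 1 := by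
      by_contra! hx
      have hmax : 1 ≤ max x 0 ^ 2 := one_le_pow₀ (hx.trans (le_max_left _ _))
      have hle := mul_max_sq_le_dirichlet (fun i => (hρ.1 i).le) (potential v W β ρ) hij
      linarith [mul_le_mul_of_nonneg_left hmax (hρ.1 i).le]
    have hM : β * M = 1 + 2 * B := mul_div_cancel₀ _ hβ.ne'
    refine le_of_mul_le_mul_left ?_ hβ
    rw [mul_sub, hM]
    linarith [abs_le.1 (hbound i), abs_le.1 (hbound j)]
  obtain ⟨k, hk⟩ := exists_inv_card_le (posSimplex_subset_stdSimplex hρ)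
  have hn : 0 < n⁻¹ := have : Nonempty V := ⟨k⟩; by positivity
  have hlog : Real.log n⁻¹ - n * M ≤ Real.log (ρ k) - n * M := by gcongr
  refine (Real.le_log_iff_exp_le (hρ.1 i)).1 (hlog.trans
    (sub_card_mul_le_of_connected hG (by positivity) k i fun i j hij hi => hstep i j hij ?_))
  exact (Real.le_log_iff_exp_le (hρ.1 i)).1 (hlog.trans hi)

lemma dotProduct_sub_le_div {a : ℝ} (ha : 0 < a) (x y : V → ℝ) :
    x ⬝ᵥ y - a / 2 * (y ⬝ᵥ y) ≤ x ⬝ᵥ x / (2 * a) := by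
  have hsq : 0 ≤ (x - a • y) ⬝ᵥ (x - a • y) := dotProduct_self_star_nonneg (x - a • y)
  simp only [dotProduct_sub, sub_dotProduct, smul_dotProduct, dotProduct_smul, smul_eq_mul,
    dotProduct_comm y x] at hsq
  rw [le_div_iff₀ (by positivity)]
  linarith

lemma freeEnergy_sub_le_dirichlet (hG : G.Connected) (hW : W.IsSymm)
    (hα : IsConvexityModulus W β α) (hβ : 0 ≤ β) (h0α : 0 < α) {q ρ : V → ℝ} {ε : ℝ} (hε : 0 < ε)
    (hq : q ∈ stdSimplex ℝ V) (hρ : ρ ∈ posSimplex V) (hερ : ∀ i, ε ≤ ρ i) :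
    freeEnergy v W β ρ - freeEnergy v W β q ≤
      Fintype.card V ^ 3 / (2 * α * ε) * dirichlet G ρ (potential v W β ρ) := by
  obtain ⟨o⟩ := hG.nonempty
  set Φ := potential v W β ρ
  set Ψ : V → ℝ := Φ - fun _ => Φ o
  have hΨ : Φ ⬝ᵥ (ρ - q) = Ψ ⬝ᵥ (ρ - q) := by
    rw [sub_dotProduct, dotProduct_eq_zero_of_forall_eq (Φ := fun _ => Φ o) (fun _ _ => rfl)
      (sum_sub_eq_zero (posSimplex_subset_stdSimplex hρ) hq), sub_zero]
  have hconv := potential_dotProduct_sub_le hW hα hβ v hq hρ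
  rw [← neg_sub ρ q, dotProduct_neg, neg_dotProduct_neg, hΨ] at hconv
  have hpoincare : Ψ ⬝ᵥ Ψ ≤ Fintype.card V * (Fintype.card V ^ 2 * dirichlet G ρ Φ / ε) := by
    rw [← nsmul_eq_mul, ← Finset.card_univ]
    refine Finset.sum_le_card_nsmul _ _ _ fun i _ => ?_
    rw [le_div_iff₀' hε, ← sq]
    exact mul_sq_sub_le_dirichlet hG hε hερ Φ i o
  calc freeEnergy v W β ρ - freeEnergy v W β q
      ≤ Ψ ⬝ᵥ (ρ - q) - α / 2 * ((ρ - q) ⬝ᵥ (ρ - q)) := by linarith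
    _ ≤ Ψ ⬝ᵥ Ψ / (2 * α) := dotProduct_sub_le_div h0α Ψ (ρ - q)
    _ ≤ Fintype.card V * (Fintype.card V ^ 2 * dirichlet G ρ Φ / ε) / (2 * α) := by gcongr
    _ = Fintype.card V ^ 3 / (2 * α * ε) * dirichlet G ρ Φ := by field_simp

/-- The dissipation controls the free energy: near the boundary of the simplex because it is bounded
below there, away from it because the graph satisfies a Poincaré inequality. -/
lemma exists_freeEnergy_sub_le_mul_dirichlet (hG : G.Connected) (hW : W.IsSymm)
    (hα : IsConvexityModulus W β α) (hβ : 0 < β) (h0α : 0 < α) (v : V → ℝ) {q : V → ℝ}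
    (hq : q ∈ stdSimplex ℝ V) : ∃ K > 0, ∀ ρ ∈ posSimplex V,
      freeEnergy v W β ρ - freeEnergy v W β q ≤ K * dirichlet G ρ (potential v W β ρ) := by
  have := hG.nonempty
  obtain ⟨ε, hε, hlow⟩ := exists_le_of_dirichlet_lt hG v W hβ
  obtain ⟨A, hA⟩ := (isCompact_stdSimplex ℝ V).bddAbove_image
    (continuous_freeEnergy v W β).continuousOn
  have hA0 : 0 ≤ A - freeEnergy v W β q := sub_nonneg.2 (hA ⟨q, hq, rfl⟩)
  refine ⟨Fintype.card V ^ 3 / (2 * α * ε) + (A - freeEnergy v W β q) / ε, by positivity,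
    fun ρ hρ => ?_⟩
  have hD := dirichlet_nonneg G (fun i => (hρ.1 i).le) (potential v W β ρ)
  rw [add_mul]
  rcases lt_or_ge (dirichlet G ρ (potential v W β ρ)) ε with hlt | hge
  · exact (freeEnergy_sub_le_dirichlet hG hW hα hβ.le h0α hε hq hρ (hlow ρ hρ hlt)).trans
      (le_add_of_nonneg_right (by positivity))
  · refine le_add_of_nonneg_of_le (by positivity) ?_
    calc freeEnergy v W β ρ - freeEnergy v W β q
        ≤ A - freeEnergy v W β q := by
          gcongr
          exact hA ⟨ρ, posSimplex_subset_stdSimplex hρ, rfl⟩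
      _ = (A - freeEnergy v W β q) / ε * ε := by field_simp
      _ ≤ (A - freeEnergy v W β q) / ε * dirichlet G ρ (potential v W β ρ) := by gcongr

end EntropyDissipation

section FluxSurjective

variable {G : SimpleGraph V} [DecidableRel G.Adj]

lemma two_mul_dotProduct_flux_le {ρ : V → ℝ} (hρ : ∀ i, 0 ≤ ρ i) (Φ Ψ : V → ℝ) :
    2 * (Ψ ⬝ᵥ flux G ρ Φ) ≤ dirichlet G ρ Φ + dirichlet G ρ Ψ := by
  simp only [dotProduct_flux, dirichlet, Finset.mul_sum, ← Finset.sum_add_distrib]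
  refine Finset.sum_le_sum fun i _ => Finset.sum_le_sum fun j _ => ?_
  have hmul : max (Φ i - Φ j) 0 * (Ψ i - Ψ j) ≤ max (Φ i - Φ j) 0 * max (Ψ i - Ψ j) 0 := by
    gcongr
    exact le_max_left _ _
  have := two_mul_le_add_sq (max (Φ i - Φ j) 0) (max (Ψ i - Ψ j) 0)
  calc 2 * (ρ i * max (Φ i - Φ j) 0 * (Ψ i - Ψ j))
      = ρ i * (2 * (max (Φ i - Φ j) 0 * (Ψ i - Ψ j))) := by ring
    _ ≤ ρ i * (max (Φ i - Φ j) 0 ^ 2 + max (Ψ i - Ψ j) 0 ^ 2) := by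
      refine mul_le_mul_of_nonneg_left ?_ (hρ i)
      linarith
    _ = _ := mul_add _ _ _

lemma max_add_sq_le (x y : ℝ) : max (x + y) 0 ^ 2 ≤ max x 0 ^ 2 + 2 * max x 0 * y + y ^ 2 := by
  rcases le_total x 0 with hx | hx <;> rcases le_total (x + y) 0 with h | h <;>
    simp only [max_eq_left, max_eq_right, hx, h] <;> nlinarith

lemma dirichlet_add_le {ρ : V → ℝ} (hρ : ∀ i, 0 ≤ ρ i) (Φ Ψ : V → ℝ) :
    dirichlet G ρ (Φ + Ψ) ≤ dirichlet G ρ Φ + 2 * (Ψ ⬝ᵥ flux G ρ Φ)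
      + ∑ i, ∑ j ∈ G.neighborFinset i, ρ i * (Ψ i - Ψ j) ^ 2 := by
  simp only [dotProduct_flux, dirichlet, Finset.mul_sum, ← Finset.sum_add_distrib]
  refine Finset.sum_le_sum fun i _ => Finset.sum_le_sum fun j _ => ?_
  have := mul_le_mul_of_nonneg_left (max_add_sq_le (Φ i - Φ j) (Ψ i - Ψ j)) (hρ i)
  rw [Pi.add_apply, Pi.add_apply, add_sub_add_comm]
  linarith

lemma flux_eq_of_forall_dirichlet_sub_le {ρ δ Φ : V → ℝ} (hρ : ∀ i, 0 ≤ ρ i)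
    (hmin : ∀ Ψ, dirichlet G ρ Φ / 2 - δ ⬝ᵥ Φ ≤ dirichlet G ρ Ψ / 2 - δ ⬝ᵥ Ψ) :
    flux G ρ Φ = δ := by
  set x := flux G ρ Φ - δ
  have hquad (s : ℝ) : 0 ≤ (∑ i, ∑ j ∈ G.neighborFinset i, ρ i * (x i - x j) ^ 2) / 2 * (s * s)
      + x ⬝ᵥ x * s + 0 := by
    have hle := dirichlet_add_le (G := G) hρ Φ (s • x)
    have hxx : x ⬝ᵥ x = x ⬝ᵥ flux G ρ Φ - δ ⬝ᵥ x := by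
      rw [dotProduct_comm δ, ← dotProduct_sub]
    have hmin := hmin (Φ + s • x)
    simp only [dotProduct_add, dotProduct_smul, smul_dotProduct, Pi.smul_apply, smul_eq_mul,
      ← mul_sub, mul_pow, mul_left_comm (ρ _), ← Finset.mul_sum] at hle hmin
    simp only [hxx, ← Finset.mul_sum]
    linarith
  have hdiscrim := discrim_le_zero hquad
  rw [discrim, mul_zero, sub_zero, sq_nonpos_iff, dotProduct_self_eq_zero] at hdiscrim
  exact sub_eq_zero.1 hdiscrim

lemma mul_norm_sq_le_dirichlet (hG : G.Connected) {ρ Φ : V → ℝ} {ε : ℝ} (hε : 0 < ε)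
    (hρ : ∀ i, ε ≤ ρ i) {o : V} (ho : Φ o = 0) :
    ε * ‖Φ‖ ^ 2 ≤ Fintype.card V ^ 2 * dirichlet G ρ Φ := by
  have := hG.nonempty
  obtain ⟨i, hi⟩ := Finite.exists_max fun i => ‖Φ i‖
  calc ε * ‖Φ‖ ^ 2 ≤ ε * ‖Φ i‖ ^ 2 := by
        gcongr
        exact (pi_norm_le_iff_of_nonneg (norm_nonneg _)).2 hi
    _ ≤ Fintype.card V ^ 2 * dirichlet G ρ Φ := by
        simpa [ho] using mul_sq_sub_le_dirichlet hG hε hρ Φ i o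

lemma eventually_dotProduct_le_dirichlet (hG : G.Connected) {ρ : V → ℝ} (hρ : ∀ i, 0 < ρ i)
    (δ : V → ℝ) (o : V) :
    ∀ᶠ Ψ in cocompact (V → ℝ) ⊓ 𝓟 {Φ | Φ o = 0}, 2 * (δ ⬝ᵥ Ψ) ≤ dirichlet G ρ Ψ := by
  have : Nonempty V := ⟨o⟩
  obtain ⟨m, hm⟩ := Finite.exists_min ρ
  rw [eventually_inf_principal]
  filter_upwards [tendsto_norm_cocompact_atTop.eventually_ge_atTop
    (2 * Fintype.card V ^ 2 * (∑ i, |δ i|) / ρ m)] with Ψ hΨ ho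
  rw [div_le_iff₀' (hρ m)] at hΨ
  have hlin : δ ⬝ᵥ Ψ ≤ (∑ i, |δ i|) * ‖Ψ‖ := by
    rw [Finset.sum_mul]
    refine Finset.sum_le_sum fun i _ => (le_abs_self _).trans ?_
    rw [abs_mul]
    exact mul_le_mul_of_nonneg_left (norm_le_pi_norm Ψ i) (abs_nonneg _)
  have hN : (0 : ℝ) < Fintype.card V ^ 2 := by positivity
  refine le_of_mul_le_mul_left ?_ hN
  calc (Fintype.card V : ℝ) ^ 2 * (2 * (δ ⬝ᵥ Ψ))
      ≤ Fintype.card V ^ 2 * (2 * ((∑ i, |δ i|) * ‖Ψ‖)) := by gcongr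
    _ = 2 * Fintype.card V ^ 2 * (∑ i, |δ i|) * ‖Ψ‖ := by ring
    _ ≤ ρ m * ‖Ψ‖ * ‖Ψ‖ := by gcongr
    _ = ρ m * ‖Ψ‖ ^ 2 := by ring
    _ ≤ Fintype.card V ^ 2 * dirichlet G ρ Ψ := mul_norm_sq_le_dirichlet hG (hρ m) hm ho

lemma exists_forall_dirichlet_sub_le (hG : G.Connected) {ρ δ : V → ℝ} (hρ : ∀ i, 0 < ρ i)
    (hδ : ∑ i, δ i = 0) :
    ∃ Φ, ∀ Ψ, dirichlet G ρ Φ / 2 - δ ⬝ᵥ Φ ≤ dirichlet G ρ Ψ / 2 - δ ⬝ᵥ Ψ := by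
  obtain ⟨o⟩ := hG.nonempty
  have hcont : Continuous fun Φ => dirichlet G ρ Φ / 2 - δ ⬝ᵥ Φ :=
    (((continuous_dirichlet G).comp (Continuous.prodMk_right ρ)).div_const 2).sub
      (continuous_const.dotProduct continuous_id)
  have hcoercive : ∀ᶠ Ψ in cocompact (V → ℝ) ⊓ 𝓟 {Φ | Φ o = 0},
      dirichlet G ρ 0 / 2 - δ ⬝ᵥ 0 ≤ dirichlet G ρ Ψ / 2 - δ ⬝ᵥ Ψ := by
    filter_upwards [eventually_dotProduct_le_dirichlet hG hρ δ o] with Ψ hΨ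
    have hzero : dirichlet G ρ 0 = 0 := by simp [dirichlet]
    rw [hzero, dotProduct_zero]
    linarith
  obtain ⟨Φ, -, hΦ⟩ := hcont.continuousOn.exists_isMinOn'
    (isClosed_eq (continuous_apply o) continuous_const) rfl hcoercive
  refine ⟨Φ, fun Ψ => ?_⟩
  have hshift : δ ⬝ᵥ (fun i => Ψ i - Ψ o) = δ ⬝ᵥ Ψ := by
    simp [dotProduct, mul_sub, ← Finset.sum_mul, hδ]
  rw [← hshift, ← dirichlet_sub_const G ρ Ψ (Ψ o)]
  exact hΦ (sub_self (Ψ o))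

lemma exists_flux_eq (hG : G.Connected) {ρ δ : V → ℝ} (hρ : ∀ i, 0 < ρ i)
    (hδ : ∑ i, δ i = 0) : ∃ Φ, flux G ρ Φ = δ :=
  let ⟨Φ, hΦ⟩ := exists_forall_dirichlet_sub_le hG hρ hδ
  ⟨Φ, flux_eq_of_forall_dirichlet_sub_le (fun i => (hρ i).le) hΦ⟩

/-- The minimum defining the rate runs over potentials, whereas the decay near the equilibrium is
governed by perturbations of total mass zero; surjectivity of the flux passes between the two. -/
lemma mul_dotProduct_mulVec_le_dirichlet (hG : G.Connected) {H : Matrix V V ℝ} {ρ δ : V → ℝ}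
    {κ : ℝ} (hκ : 0 ≤ κ) (hρ : ∀ i, 0 < ρ i)
    (hH : ∀ Φ, κ * dirichlet G ρ Φ ≤ flux G ρ Φ ⬝ᵥ H *ᵥ flux G ρ Φ) (hδ : ∑ i, δ i = 0) :
    κ * (δ ⬝ᵥ H *ᵥ δ) ≤ dirichlet G ρ (H *ᵥ δ) := by
  obtain ⟨Φ, rfl⟩ := exists_flux_eq hG hρ hδ
  set δ := flux G ρ Φ with hδΦ
  have hyoung := two_mul_dotProduct_flux_le (G := G) (fun i => (hρ i).le) (κ • Φ) (H *ᵥ δ)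
  rw [flux_smul G ρ Φ hκ, dirichlet_smul G ρ Φ hκ, dotProduct_smul, smul_eq_mul, ← hδΦ,
    dotProduct_comm] at hyoung
  linarith [mul_le_mul_of_nonneg_left (hH Φ) hκ]

end FluxSurjective

section Rate

variable {G : SimpleGraph V} [DecidableRel G.Adj] {p : V → ℝ} {Δx lam : ℝ}

lemma max_div_zero (x : ℝ) {d : ℝ} (hd : 0 ≤ d) : max (x / d) 0 = max x 0 / d := by
  rw [← max_div_div_right hd, zero_div]

lemma mem_rateDomain_iff (hΔx : 0 < Δx) {Φ : V → ℝ} :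
    Φ ∈ rateDomain G Δx p ↔ dirichlet G p Φ = Δx ^ 2 := by
  rw [rateDomain, Set.mem_ofPred_eq, ← div_eq_one_iff_eq (a := dirichlet G p Φ) (by positivity)]
  simp only [dirichlet, Finset.sum_div, max_div_zero _ hΔx.le, div_pow, div_mul_eq_mul_div,
    mul_comm (p _)]

lemma isCompact_setOf_dirichlet_eq (hG : G.Connected) (hp : ∀ i, 0 < p i) (o : V) (r : ℝ) :
    IsCompact {Φ | Φ o = 0 ∧ dirichlet G p Φ = r} := by
  have : Nonempty V := ⟨o⟩
  obtain ⟨m, hm⟩ := Finite.exists_min p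
  refine (isCompact_closedBall (0 : V → ℝ) √(Fintype.card V ^ 2 * r / p m)).of_isClosed_subset
    ((isClosed_eq (continuous_apply o) continuous_const).inter
      (isClosed_eq ((continuous_dirichlet G).comp (Continuous.prodMk_right p))
        continuous_const)) ?_
  rintro Φ ⟨ho, rfl⟩
  rw [mem_closedBall_zero_iff]
  refine Real.le_sqrt_of_sq_le ?_
  rw [le_div_iff₀' (hp m)]
  exact mul_norm_sq_le_dirichlet hG (hp m) hm ho

lemma exists_dirichlet_pos [Nontrivial V] (hG : G.Connected) (hp : ∀ i, 0 < p i) :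
    ∃ Φ, 0 < dirichlet G p Φ := by
  classical
  obtain ⟨o, i, hoi⟩ := exists_pair_ne V
  obtain ⟨m, hm⟩ := Finite.exists_min p
  have hpoincare := mul_sq_sub_le_dirichlet hG (hp m) hm (Pi.single i 1) i o
  rw [Pi.single_eq_same, Pi.single_eq_of_ne hoi, sub_zero, one_pow, mul_one] at hpoincare
  exact ⟨_, pos_of_mul_pos_right ((hp m).trans_le hpoincare) (sq_nonneg _)⟩

lemma exists_dirichlet_smul_eq (hΔx : 0 < Δx) {Φ : V → ℝ} (hΦ : 0 < dirichlet G p Φ) :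
    ∃ s > (0 : ℝ), dirichlet G p (s • Φ) = Δx ^ 2 := by
  refine ⟨Δx / √(dirichlet G p Φ), by positivity, ?_⟩
  rw [dirichlet_smul G p Φ (by positivity), div_pow, Real.sq_sqrt hΦ.le,
    div_mul_cancel₀ _ hΦ.ne']

variable [DecidableEq V]

lemma rateForm_eq (hW : W.IsSymm) (hΔx : 0 ≤ Δx) (hp : ∀ i, 0 < p i) (Φ : V → ℝ) :
    rateForm G v W β Δx p Φ =
      (flux G p Φ ⬝ᵥ hessian W β p *ᵥ flux G p Φ) / Δx ^ 4 := by
  set H := hessian W β p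
  have hinner (i j : V) : (H *ᵥ flux G p Φ) i - (H *ᵥ flux G p Φ) j =
      ∑ k, ∑ l ∈ G.neighborFinset k, p k * max (Φ k - Φ l) 0 * (H i k + H j l - H i l - H j k) := by
    have hsub : (H *ᵥ flux G p Φ) i - (H *ᵥ flux G p Φ) j = (H i - H j) ⬝ᵥ flux G p Φ :=
      (sub_dotProduct ..).symm
    rw [hsub, dotProduct_flux]
    refine Finset.sum_congr rfl fun k _ => Finset.sum_congr rfl fun l _ => ?_
    simp only [Pi.sub_apply]
    ring
  rw [dotProduct_comm, dotProduct_flux]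
  simp only [hinner, rateForm, hCoeff, secondVar_eq hW hp, max_div_zero _ hΔx, Finset.mul_sum,
    Finset.sum_div]
  refine Finset.sum_congr rfl fun i _ => Finset.sum_congr rfl fun j _ =>
    Finset.sum_congr rfl fun k _ => Finset.sum_congr rfl fun l _ => ?_
  ring

lemma exists_isRate [Nontrivial V] (hG : G.Connected) (hW : W.IsSymm) (hΔx : 0 < Δx)
    (hp : ∀ i, 0 < p i) : ∃ lam, IsRate G v W β Δx p lam := by
  obtain ⟨o⟩ := hG.nonempty
  have hnormalize (Φ : V → ℝ) (hΦ : dirichlet G p Φ = Δx ^ 2) :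
      (fun i => Φ i - Φ o) ∈ {Φ | Φ o = 0 ∧ dirichlet G p Φ = Δx ^ 2} :=
    ⟨sub_self _, by rw [dirichlet_sub_const, hΦ]⟩
  obtain ⟨Φ, hΦ⟩ := exists_dirichlet_pos hG hp
  obtain ⟨s, -, hs⟩ := exists_dirichlet_smul_eq hΔx hΦ
  have hcont : Continuous (rateForm G v W β Δx p) := by
    simp only [funext (rateForm_eq hW hΔx.le hp)]
    have hflux : Continuous (flux G p) := (continuous_flux G).comp (Continuous.prodMk_right p)
    exact (hflux.dotProduct (continuous_const.matrix_mulVec hflux)).div_const _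
  obtain ⟨Ψ, hΨ, hmin⟩ := (isCompact_setOf_dirichlet_eq hG hp o (Δx ^ 2)).exists_isMinOn
    ⟨_, hnormalize _ hs⟩ hcont.continuousOn
  refine ⟨_, ⟨Ψ, (mem_rateDomain_iff hΔx).2 hΨ.2, rfl⟩, ?_⟩
  rintro _ ⟨Φ, hΦ, rfl⟩
  have := hmin (hnormalize Φ ((mem_rateDomain_iff hΔx).1 hΦ))
  rwa [mem_ofPred_eq, rateForm_eq hW hΔx.le hp (fun i => Φ i - Φ o), flux_sub_const,
    ← rateForm_eq hW hΔx.le hp] at this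

lemma mul_dotProduct_self_le_hessian (hα : IsConvexityModulus W β α) (hβ : 0 ≤ β)
    (hp : p ∈ posSimplex V) {x : V → ℝ} (hx : ∑ i, x i = 0) :
    α * (x ⬝ᵥ x) ≤ x ⬝ᵥ hessian W β p *ᵥ x := by
  rw [hessian_mulVec, dotProduct_add]
  refine (hα x hx).trans (add_le_add_right ?_ _)
  rw [dotProduct, Finset.mul_sum]
  refine Finset.sum_le_sum fun i _ => ?_
  have hle : β ≤ β / p i :=
    le_div_self hβ (hp.1 i) (le_one_of_mem_stdSimplex (posSimplex_subset_stdSimplex hp) i)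
  nlinarith [mul_le_mul_of_nonneg_right hle (mul_self_nonneg (x i))]

lemma IsRate.pos (hW : W.IsSymm) (hα : IsConvexityModulus W β α) (hβ : 0 ≤ β) (h0α : 0 < α)
    (hΔx : 0 < Δx) (hp : p ∈ posSimplex V) (hlam : IsRate G v W β Δx p lam) : 0 < lam := by
  obtain ⟨Φ, hΦ, rfl⟩ := hlam.1
  rw [mem_rateDomain_iff hΔx, ← dotProduct_flux_self] at hΦ
  have hflux : flux G p Φ ≠ 0 := fun h => by
    rw [h, dotProduct_zero] at hΦ
    exact (pow_pos hΔx 2).ne hΦ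
  have hpos : 0 < flux G p Φ ⬝ᵥ flux G p Φ := dotProduct_self_star_pos_iff.2 hflux
  rw [rateForm_eq hW hΔx.le hp.1]
  exact div_pos ((mul_pos h0α hpos).trans_le
    (mul_dotProduct_self_le_hessian hα hβ hp (sum_flux G p Φ))) (by positivity)

lemma IsRate.mul_dirichlet_le (hW : W.IsSymm) (hα : IsConvexityModulus W β α) (hβ : 0 ≤ β)
    (h0α : 0 ≤ α) (hΔx : 0 < Δx) (hp : p ∈ posSimplex V) (hlam : IsRate G v W β Δx p lam)
    (Φ : V → ℝ) :
    lam * Δx ^ 2 * dirichlet G p Φ ≤ flux G p Φ ⬝ᵥ hessian W β p *ᵥ flux G p Φ := by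
  rcases (dirichlet_nonneg G (fun i => (hp.1 i).le) Φ).eq_or_lt with hzero | hpos
  · rw [← hzero, mul_zero]
    exact (mul_nonneg h0α (dotProduct_self_star_nonneg _)).trans
      (mul_dotProduct_self_le_hessian hα hβ hp (sum_flux G p Φ))
  · obtain ⟨s, hs, hsΦ⟩ := exists_dirichlet_smul_eq hΔx hpos
    have hle := hlam.2 ⟨s • Φ, (mem_rateDomain_iff hΔx).2 hsΦ, rfl⟩
    rw [rateForm_eq hW hΔx.le hp.1, le_div_iff₀ (by positivity), flux_smul G p Φ hs.le,
      mulVec_smul, smul_dotProduct, dotProduct_smul, smul_smul, smul_eq_mul] at hle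
    rw [dirichlet_smul G p Φ hs.le] at hsΦ
    refine le_of_mul_le_mul_left (le_trans (le_of_eq ?_) hle) (mul_pos hs hs)
    linear_combination lam * Δx ^ 2 * hsΦ

end Rate

section LocalExpansion

open Asymptotics

lemma isLittleO_log_sub {y : ℝ} (hy : y ≠ 0) :
    (fun x => Real.log x - Real.log y - (x - y) / y) =o[𝓝 y] fun x => x - y := by
  simpa only [smul_eq_mul, div_eq_mul_inv] using (Real.hasDerivAt_log hy).isLittleO

lemma isLittleO_mul_log_div_sub {y : ℝ} (hy : 0 < y) :
    (fun x => x * Real.log (x / y) - x + y - (x - y) ^ 2 / (2 * y)) =o[𝓝 y]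
      fun x => (x - y) ^ 2 := by
  have hderiv (x : ℝ) (hx : x ∈ Ioi 0) :
      HasDerivWithinAt (fun x => x * Real.log (x / y) - x + y - (x - y) ^ 2 / (2 * y))
        (Real.log x - Real.log y - (x - y) / y) (Ioi 0) x := by
    have hlog := ((hasDerivAt_id x).div_const y).log (div_pos hx hy).ne'
    have hsq := (((hasDerivAt_id x).sub_const y).pow 2).div_const (2 * y)
    refine (((((hasDerivAt_id x).mul hlog).sub (hasDerivAt_id x)).add_const y).sub
      hsq).congr_deriv ?_ |>.hasDerivWithinAt
    rw [← Real.log_div (ne_of_gt hx) hy.ne']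
    have hx' : x ≠ 0 := ne_of_gt hx
    simp only [id]
    field_simp
    norm_num
    ring
  have hnhds : 𝓝[Ioi 0] y = 𝓝 y := isOpen_Ioi.nhdsWithin_eq hy
  have := (convex_Ioi 0).isLittleO_pow_succ_real (n := 1) hy hderiv
    (by simpa only [hnhds, pow_one] using isLittleO_log_sub hy.ne')
  simpa [hnhds, hy.ne'] using this

lemma isLittleO_mul_max_sq_sub {ι : Type*} {l : Filter ι} {w a b g : ι → ℝ} {w₀ : ℝ}
    (hw : Tendsto w l (𝓝 w₀)) (hab : (fun x => a x - b x) =o[l] g) (hb : b =O[l] g) :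
    (fun x => w x * max (a x) 0 ^ 2 - w₀ * max (b x) 0 ^ 2) =o[l] fun x => g x ^ 2 := by
  have hmax {f : ι → ℝ} (hf : f =O[l] g) : (fun x => max (f x) 0) =O[l] g :=
    (IsBigO.of_norm_le fun x => by simpa using abs_max_sub_max_le_abs (f x) 0 0).trans
      hf.norm_left
  have hsub : (fun x => max (a x) 0 - max (b x) 0) =o[l] g :=
    (IsBigO.of_norm_le fun x => abs_max_sub_max_le_abs (a x) (b x) 0).trans_isLittleO
      hab.norm_left
  have ha : a =O[l] g := (hab.isBigO.add hb).congr_left fun x => sub_add_cancel _ _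
  have hweight : (fun x => (w x - w₀) * max (a x) 0 ^ 2) =o[l] fun x => g x ^ 2 := by
    have : (fun x => w x - w₀) =o[l] fun _ => (1 : ℝ) :=
      (isLittleO_one_iff ℝ).2 (tendsto_sub_nhds_zero_iff.2 hw)
    simpa only [one_mul] using this.mul_isBigO ((hmax ha).pow 2)
  have hsquare : (fun x => (max (a x) 0 - max (b x) 0) * (max (a x) 0 + max (b x) 0)) =o[l]
      fun x => g x ^ 2 := by
    simpa only [sq] using hsub.mul_isBigO ((hmax ha).add (hmax hb))
  exact (hweight.add (hsquare.const_mul_left w₀)).congr_left fun x => by ring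

lemma isBigO_apply_sub (p : V → ℝ) (i : V) (l : Filter (V → ℝ)) :
    (fun ρ : V → ℝ => ρ i - p i) =O[l] fun ρ => ‖ρ - p‖ :=
  IsBigO.of_norm_le fun ρ => norm_le_pi_norm (ρ - p) i

lemma isBigO_mulVec_sub (H : Matrix V V ℝ) (p : V → ℝ) (i : V) (l : Filter (V → ℝ)) :
    (fun ρ => (H *ᵥ (ρ - p)) i) =O[l] fun ρ => ‖ρ - p‖ :=
  IsBigO.fun_sum fun j _ => (isBigO_apply_sub p j l).const_mul_left _

lemma isLittleO_relEntropy {p : V → ℝ} (hp : ∀ i, 0 < p i) :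
    (fun ρ => relEntropy ρ p - ∑ i, (ρ i - p i) ^ 2 / (2 * p i)) =o[𝓝 p]
      fun ρ => ‖ρ - p‖ ^ 2 := by
  simp only [relEntropy, ← Finset.sum_sub_distrib]
  exact IsLittleO.fun_sum fun i _ => ((isLittleO_mul_log_div_sub (hp i)).comp_tendsto
    ((continuous_apply i).tendsto p)).trans_isBigO ((isBigO_apply_sub p i _).pow 2)

lemma norm_sq_le_dotProduct_self (x : V → ℝ) : ‖x‖ ^ 2 ≤ x ⬝ᵥ x := by
  suffices ‖x‖ ≤ √(x ⬝ᵥ x) from (Real.le_sqrt (norm_nonneg x)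
    (dotProduct_self_star_nonneg x)).1 this
  refine (pi_norm_le_iff_of_nonneg (Real.sqrt_nonneg _)).2 fun i => Real.le_sqrt_of_sq_le ?_
  rw [Real.norm_eq_abs, sq_abs, sq]
  exact Finset.single_le_sum (f := fun i => x i * x i) (fun i _ => mul_self_nonneg _)
    (Finset.mem_univ i)

variable [DecidableEq V] {p : V → ℝ}

lemma isLittleO_potential_sub (v : V → ℝ) (W : Matrix V V ℝ) (β : ℝ) (hp : ∀ i, 0 < p i) (i : V) :
    (fun ρ => potential v W β ρ i - potential v W β p i - (hessian W β p *ᵥ (ρ - p)) i) =o[𝓝 p]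
      fun ρ => ‖ρ - p‖ := by
  have hlog := ((isLittleO_log_sub (hp i).ne').comp_tendsto
    ((continuous_apply i).tendsto p)).trans_isBigO (isBigO_apply_sub p i _)
  refine (hlog.const_mul_left β).congr_left fun ρ => ?_
  simp only [potential, hessian_mulVec, mulVec_sub, Pi.add_apply, Pi.sub_apply, Function.comp]
  ring

lemma IsGibbs.isLittleO_freeEnergy (hW : W.IsSymm) (hβ : β ≠ 0) (hp : IsGibbs v W β p) :
    (fun ρ => freeEnergy v W β ρ - freeEnergy v W β p
      - 1 / 2 * ((ρ - p) ⬝ᵥ hessian W β p *ᵥ (ρ - p))) =o[𝓝[posSimplex V] p]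
      fun ρ => ‖ρ - p‖ ^ 2 := by
  have hpos := ((isGibbs_iff hβ).1 hp).1.1
  refine (((isLittleO_relEntropy hpos).const_mul_left β).mono nhdsWithin_le_nhds).congr' ?_
    EventuallyEq.rfl
  filter_upwards [self_mem_nhdsWithin] with ρ hρ
  have hdiag : (ρ - p) ⬝ᵥ (fun i => β / p i * (ρ - p) i) =
      2 * (β * ∑ i, (ρ i - p i) ^ 2 / (2 * p i)) := by
    simp only [dotProduct, Pi.sub_apply, Finset.mul_sum]
    exact Finset.sum_congr rfl fun i _ => by field_simp [(hpos i).ne']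
  rw [freeEnergy_sub hW v β ρ hpos, hp.dotProduct_potential_sub hβ hρ, hessian_mulVec,
    dotProduct_add, hdiag]
  ring

variable (G : SimpleGraph V) [DecidableRel G.Adj]

lemma IsGibbs.isLittleO_dirichlet (hβ : β ≠ 0) (hp : IsGibbs v W β p) :
    (fun ρ => dirichlet G ρ (potential v W β ρ) - dirichlet G p (hessian W β p *ᵥ (ρ - p)))
      =o[𝓝 p] fun ρ => ‖ρ - p‖ ^ 2 := by
  obtain ⟨⟨hpos, -⟩, heq⟩ := (isGibbs_iff hβ).1 hp
  simp only [dirichlet, ← Finset.sum_sub_distrib]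
  refine IsLittleO.fun_sum fun i _ => IsLittleO.fun_sum fun j _ => isLittleO_mul_max_sq_sub
    ((continuous_apply i).tendsto p) ?_
    ((isBigO_mulVec_sub _ p i _).sub (isBigO_mulVec_sub _ p j _))
  refine ((isLittleO_potential_sub v W β hpos i).sub
    (isLittleO_potential_sub v W β hpos j)).congr_left fun ρ => ?_
  rw [heq i j]
  ring

variable {G}

lemma IsGibbs.eventually_mul_freeEnergy_sub_le_dirichlet (hW : W.IsSymm)
    (hα : IsConvexityModulus W β α) (hβ : 0 < β) (h0α : 0 < α) (hp : IsGibbs v W β p) {κ η : ℝ}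
    (hκ : ∀ δ : V → ℝ, ∑ i, δ i = 0 →
      κ * (δ ⬝ᵥ hessian W β p *ᵥ δ) ≤ dirichlet G p (hessian W β p *ᵥ δ)) (hη : 0 < η) :
    ∀ᶠ ρ in 𝓝[posSimplex V] p, 2 * (κ - η) * (freeEnergy v W β ρ - freeEnergy v W β p) ≤
      dirichlet G ρ (potential v W β ρ) := by
  have henergy := (hp.isLittleO_freeEnergy hW hβ.ne').const_mul_left (2 * (κ - η))
  have hdirichlet := (hp.isLittleO_dirichlet G hβ.ne').mono
    (nhdsWithin_le_nhds (s := posSimplex V))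
  filter_upwards [isLittleO_iff.1 (hdirichlet.sub henergy) (mul_pos hη h0α),
    self_mem_nhdsWithin] with ρ hexpand hρ
  have hsum := sum_sub_eq_zero (posSimplex_subset_stdSimplex hρ) hp.1
  have hform : α * ‖ρ - p‖ ^ 2 ≤ (ρ - p) ⬝ᵥ hessian W β p *ᵥ (ρ - p) :=
    (mul_le_mul_of_nonneg_left (norm_sq_le_dotProduct_self _) h0α.le).trans
      (mul_dotProduct_self_le_hessian hα hβ.le ((isGibbs_iff hβ.ne').1 hp).1 hsum)
  rw [Real.norm_eq_abs, Real.norm_of_nonneg (sq_nonneg ‖ρ - p‖)] at hexpand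
  linarith [(abs_le.1 hexpand).1, hκ _ hsum, mul_le_mul_of_nonneg_left hform hη.le]

end LocalExpansion

section WellPosedness

lemma lipschitzWith_of_forall_apply {E ι : Type*} [PseudoMetricSpace E] [Fintype ι] {K : NNReal}
    {f : E → ι → ℝ} (hf : ∀ i, LipschitzWith K fun x => f x i) : LipschitzWith K f :=
  LipschitzWith.of_dist_le_mul fun x y =>
    (dist_pi_le_iff (by positivity)).2 fun i => (hf i).dist_le_mul x y

lemma exists_lipschitzWith_retraction_Icc {ι : Type*} [Fintype ι] {a b : ι → ℝ} (hab : a ≤ b) :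
    ∃ r : (ι → ℝ) → ι → ℝ, LipschitzWith 1 r ∧ (∀ x, r x ∈ Icc a b) ∧ ∀ x ∈ Icc a b, r x = x :=
  ⟨fun x i => projIcc (a i) (b i) (hab i) (x i),
    lipschitzWith_of_forall_apply fun i => by
      simpa [Function.comp_def] using (LipschitzWith.subtype_val _).comp
        ((LipschitzWith.projIcc (hab i)).comp (LipschitzWith.eval i)),
    fun x => ⟨fun i => (projIcc _ _ _ _).2.1, fun i => (projIcc _ _ _ _).2.2⟩,
    fun x hx => funext fun i =>
      congrArg Subtype.val (projIcc_of_mem (hab i) ⟨hx.1 i, hx.2 i⟩)⟩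

/-- Solving the equation for the field precomposed with the projection onto the box postpones the
question whether the solution stays in the box. -/
lemma exists_hasDerivWithinAt_of_lipschitzOnWith {ι : Type*} [Fintype ι] {a b : ι → ℝ}
    (hab : a ≤ b) {f : (ι → ℝ) → ι → ℝ} {K : NNReal} (hf : LipschitzOnWith K f (Icc a b))
    (x₀ : ι → ℝ) {T : ℝ} (hT : 0 ≤ T) :
    ∃ γ γ₁ : ℝ → ι → ℝ, γ 0 = x₀ ∧ (∀ t, γ₁ t ∈ Icc a b ∧ (γ t ∈ Icc a b → γ₁ t = γ t)) ∧
      ∀ t ∈ Icc 0 T, HasDerivWithinAt γ (f (γ₁ t)) (Icc 0 T) t := by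
  obtain ⟨r, hr, hmem, hfix⟩ := exists_lipschitzWith_retraction_Icc hab
  obtain ⟨M, hM⟩ := isCompact_Icc.exists_bound_of_continuousOn hf.continuousOn
  have hlip : LipschitzWith (K * 1) (f ∘ r) :=
    lipschitzOnWith_univ.1 (hf.comp hr.lipschitzOnWith fun x _ => hmem x)
  have hPL : IsPicardLindelof (fun _ => f ∘ r) (tmin := 0) (tmax := T) ⟨0, le_rfl, hT⟩ x₀
      (M.toNNReal * T.toNNReal) 0 M.toNNReal (K * 1) :=
    { lipschitzOnWith := fun _ _ => hlip.lipschitzOnWith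
      continuousOn := fun _ _ => continuousOn_const
      norm_le := fun _ _ x _ => (hM (r x) (hmem x)).trans (Real.le_coe_toNNReal M)
      mul_max_le := by simp [hT] }
  obtain ⟨γ, hγ₀, hγ⟩ := hPL.exists_eq_forall_mem_Icc_hasDerivWithinAt₀
  exact ⟨γ, r ∘ γ, hγ₀, fun t => ⟨hmem (γ t), hfix (γ t)⟩, hγ⟩

lemma eventually_pos_of_hasDerivWithinAt {f : ℝ → ℝ} {f' x : ℝ}
    (hf : HasDerivWithinAt f f' (Ioi x) x) (h0 : f x = 0) (hf' : 0 < f') :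
    ∀ᶠ y in 𝓝[>] x, 0 < f y := by
  have hslope := (hasDerivWithinAt_iff_tendsto_slope' self_notMem_Ioi).1 hf
  filter_upwards [hslope.eventually_const_lt hf', self_mem_nhdsWithin] with y hy hxy
  rw [slope_def_field, h0, sub_zero] at hy
  exact (div_pos_iff_of_pos_right (sub_pos.2 hxy)).1 hy

lemma nonneg_of_hasDerivWithinAt {ι : Type*} [Finite ι] {h h' : ℝ → ι → ℝ} {T : ℝ}
    (hh : ∀ t ∈ Icc 0 T, HasDerivWithinAt h (h' t) (Icc 0 T) t) (h0 : 0 ≤ h 0)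
    (hin : ∀ t ∈ Icc 0 T, 0 ≤ h t → ∀ i, h t i = 0 → 0 < h' t i) :
    ∀ t ∈ Icc 0 T, 0 ≤ h t := by
  have : Fintype ι := Fintype.ofFinite ι
  have hcont : ContinuousOn h (Icc 0 T) := fun t ht => (hh t ht).continuousWithinAt
  have hclosed : IsClosed ({t | 0 ≤ h t} ∩ Icc 0 T) := by
    rw [inter_comm]
    exact hcont.preimage_isClosed_of_isClosed isClosed_Icc isClosed_Ici
  refine hclosed.Icc_subset_of_forall_mem_nhdsWithin h0 fun t ⟨ht, htT⟩ => ?_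
  have hIoi := (hh t (Ico_subset_Icc_self htT)).mono_of_mem_nhdsWithin
    (mem_of_superset (Ioc_mem_nhdsGT htT.2) fun s hs => ⟨htT.1.trans hs.1.le, hs.2⟩)
  refine eventually_all.2 fun i => ?_
  have hi := hasDerivWithinAt_pi.1 hIoi i
  rcases (ht i).eq_or_lt with hi0 | hi0
  · exact (eventually_pos_of_hasDerivWithinAt hi hi0.symm
      (hin t (Ico_subset_Icc_self htT) ht i hi0.symm)).mono fun s hs => hs.le
  · exact (hi.continuousWithinAt.eventually_const_lt hi0).mono fun s hs => hs.le

lemma exp_neg_mul_le_of_hasDerivWithinAt {ι : Type*} [Finite ι] {γ γ' : ℝ → ι → ℝ} {T m C : ℝ}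
    (hγ : ∀ t ∈ Icc 0 T, HasDerivWithinAt γ (γ' t) (Icc 0 T) t) (h0 : ∀ i, m ≤ γ 0 i)
    (hin : ∀ t ∈ Icc 0 T, (∀ j, m * Real.exp (-C * t) ≤ γ t j) → ∀ i,
      γ t i = m * Real.exp (-C * t) → -C * γ t i < γ' t i) :
    ∀ t ∈ Icc 0 T, ∀ i, m * Real.exp (-C * t) ≤ γ t i := by
  have : Fintype ι := Fintype.ofFinite ι
  have hexp (t : ℝ) : HasDerivAt (fun t => m * Real.exp (-C * t))
      (m * (Real.exp (-C * t) * -C)) t := by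
    simpa using (((hasDerivAt_id t).const_mul (-C)).exp).const_mul m
  have hnonneg := nonneg_of_hasDerivWithinAt (h := fun t i => γ t i - m * Real.exp (-C * t))
    (h' := fun t i => γ' t i - m * (Real.exp (-C * t) * -C))
    (fun t ht => hasDerivWithinAt_pi.2 fun i =>
      (hasDerivWithinAt_pi.1 (hγ t ht) i).sub (hexp t).hasDerivWithinAt)
    (fun i => by simpa using h0 i) fun t ht hge i hi => ?_
  · exact fun t ht i => sub_nonneg.1 (hnonneg t ht i)
  · have hi' := sub_eq_zero.1 hi
    have := hin t ht (fun j => sub_nonneg.1 (hge j)) i hi'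
    rw [hi'] at this
    linarith

lemma hasDerivWithinAt_Ici_of_Icc {E : Type*} [NormedAddCommGroup E] [NormedSpace ℝ E]
    {γ : ℝ → E} {γ' : E} {a b t : ℝ} (ht : t ∈ Ico a b) (h : HasDerivWithinAt γ γ' (Icc a b) t) :
    HasDerivWithinAt γ γ' (Ici t) t :=
  h.mono_of_mem_nhdsWithin (Icc_mem_nhdsGE_of_mem ht)

lemma sum_apply_eq_of_hasDerivWithinAt {ι : Type*} [Fintype ι] {γ γ' : ℝ → ι → ℝ} {a b : ℝ}
    (hγ : ∀ t ∈ Icc a b, HasDerivWithinAt γ (γ' t) (Icc a b) t)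
    (hsum : ∀ t ∈ Icc a b, ∑ i, γ' t i = 0) : ∀ t ∈ Icc a b, ∑ i, γ t i = ∑ i, γ a i := by
  have hderiv : ∀ t ∈ Icc a b, HasDerivWithinAt (fun t => ∑ i, γ t i) 0 (Icc a b) t :=
    fun t ht => (HasDerivWithinAt.fun_sum fun i _ =>
      hasDerivWithinAt_pi.1 (hγ t ht) i).congr_deriv (hsum t ht)
  exact constant_of_has_deriv_right_zero (fun t ht => (hderiv t ht).continuousWithinAt)
    fun t ht => hasDerivWithinAt_Ici_of_Icc ht (hderiv t (Ico_subset_Icc_self ht))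

lemma eqOn_Icc_of_locallyLipschitzOn {E : Type*} [NormedAddCommGroup E] [NormedSpace ℝ E]
    {f : E → E} {s : Set E} (hf : LocallyLipschitzOn s f) {γ σ : ℝ → E} {a b : ℝ}
    (hγ : ∀ t ∈ Icc a b, γ t ∈ s ∧ HasDerivWithinAt γ (f (γ t)) (Icc a b) t)
    (hσ : ∀ t ∈ Icc a b, σ t ∈ s ∧ HasDerivWithinAt σ (f (σ t)) (Icc a b) t)
    (h0 : γ a = σ a) : EqOn γ σ (Icc a b) := by
  have hγc : ContinuousOn γ (Icc a b) := fun t ht => (hγ t ht).2.continuousWithinAt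
  have hσc : ContinuousOn σ (Icc a b) := fun t ht => (hσ t ht).2.continuousWithinAt
  have hsub : γ '' Icc a b ∪ σ '' Icc a b ⊆ s :=
    union_subset (image_subset_iff.2 fun t ht => (hγ t ht).1)
      (image_subset_iff.2 fun t ht => (hσ t ht).1)
  obtain ⟨K, hK⟩ := (hf.mono hsub).exists_lipschitzOnWith_of_compact
    ((isCompact_Icc.image_of_continuousOn hγc).union (isCompact_Icc.image_of_continuousOn hσc))
  exact ODE_solution_unique_of_mem_Icc_right (v := fun _ => f) (fun _ _ => hK)
    hγc (fun t ht => hasDerivWithinAt_Ici_of_Icc ht (hγ t (Ico_subset_Icc_self ht)).2)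
    (fun t ht => .inl (mem_image_of_mem γ (Ico_subset_Icc_self ht)))
    hσc (fun t ht => hasDerivWithinAt_Ici_of_Icc ht (hσ t (Ico_subset_Icc_self ht)).2)
    (fun t ht => .inr (mem_image_of_mem σ (Ico_subset_Icc_self ht))) h0

lemma exists_hasDerivWithinAt_of_locallyLipschitzOn {f : (V → ℝ) → V → ℝ}
    (hf : LocallyLipschitzOn {ρ | ∀ i, 0 < ρ i} f) (hsum : ∀ ρ, (∀ i, 0 < ρ i) → ∑ i, f ρ i = 0)
    {ρ₀ : V → ℝ} (hρ₀ : ρ₀ ∈ posSimplex V) {ε : ℝ} (hε : 0 < ε) (hle : ∀ i, ε ≤ ρ₀ i) {T : ℝ}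
    (hT : 0 ≤ T) :
    ∃ γ γ₁ : ℝ → V → ℝ, γ 0 = ρ₀ ∧
      (∀ t ∈ Icc 0 T, (∀ i, ε ≤ γ t i) → γ t ∈ posSimplex V ∧ γ₁ t = γ t) ∧
      ∀ t ∈ Icc 0 T, HasDerivWithinAt γ (f (γ₁ t)) (Icc 0 T) t := by
  have hle_one {ρ : V → ℝ} (hρ : ρ ∈ posSimplex V) : ρ ≤ 1 :=
    le_one_of_mem_stdSimplex (posSimplex_subset_stdSimplex hρ)
  have hbox : (fun _ => ε) ≤ (1 : V → ℝ) := le_trans hle (hle_one hρ₀)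
  have hpos : Icc (fun _ : V => ε) 1 ⊆ {ρ | ∀ i, 0 < ρ i} := fun ρ hρ i => hε.trans_le (hρ.1 i)
  obtain ⟨K, hK⟩ := (hf.mono hpos).exists_lipschitzOnWith_of_compact isCompact_Icc
  obtain ⟨γ, γ₁, hγ₀, hγ₁, hγ⟩ := exists_hasDerivWithinAt_of_lipschitzOnWith hbox hK ρ₀ hT
  refine ⟨γ, γ₁, hγ₀, fun t ht hge => ?_, hγ⟩
  have hmass : ∑ i, γ t i = 1 := by
    rw [sum_apply_eq_of_hasDerivWithinAt hγ (fun s _ => hsum _ (hpos (hγ₁ s).1)) t ht, hγ₀, hρ₀.2]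
  have hγt : γ t ∈ posSimplex V := ⟨fun i => hε.trans_le (hge i), hmass⟩
  exact ⟨hγt, (hγ₁ t).2 ⟨hge, hle_one hγt⟩⟩

variable {G : SimpleGraph V} [DecidableRel G.Adj]

lemma flux_apply_le {ρ Φ : V → ℝ} {b : ℝ} {i : V} (hρ : ∀ j, 0 ≤ ρ j) (hb : 0 ≤ b)
    (hΦ : ∀ j, Φ i - Φ j ≤ b) : flux G ρ Φ i ≤ Fintype.card V * b * ρ i := by
  have hin : 0 ≤ ∑ j ∈ G.neighborFinset i, ρ j * max (Φ j - Φ i) 0 :=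
    Finset.sum_nonneg fun j _ => mul_nonneg (hρ j) (le_max_right _ _)
  calc flux G ρ Φ i ≤ ∑ j ∈ G.neighborFinset i, ρ i * max (Φ i - Φ j) 0 := sub_le_self _ hin
    _ ≤ ∑ j, ρ i * max (Φ i - Φ j) 0 := Finset.sum_le_univ_sum_of_nonneg fun j =>
        mul_nonneg (hρ i) (le_max_right _ _)
    _ ≤ ∑ _j : V, ρ i * b := Finset.sum_le_sum fun j _ =>
        mul_le_mul_of_nonneg_left (max_le (hΦ j) hb) (hρ i)
    _ = Fintype.card V * b * ρ i := by simp [mul_assoc, mul_comm b]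

lemma locallyLipschitz_flux (G : SimpleGraph V) [DecidableRel G.Adj] :
    LocallyLipschitz fun z : (V → ℝ) × (V → ℝ) => flux G z.1 z.2 := by
  have hpoly : ContDiff ℝ 1 fun z : (V → ℝ) × (V × V → ℝ) => fun i =>
      ∑ j ∈ G.neighborFinset i, z.1 i * z.2 (i, j)
        - ∑ j ∈ G.neighborFinset i, z.1 j * z.2 (j, i) := by
    fun_prop
  have heval (i : V) : LipschitzWith 1 fun Φ : V → ℝ => Φ i := LipschitzWith.eval i
  have hpart : LipschitzWith (1 + 1) fun (Φ : V → ℝ) (e : V × V) => max (Φ e.1 - Φ e.2) 0 :=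
    lipschitzWith_of_forall_apply fun e => ((heval e.1).sub (heval e.2)).max_const 0
  have hpair : LocallyLipschitz fun z : (V → ℝ) × (V → ℝ) =>
      (z.1, fun e : V × V => max (z.2 e.1 - z.2 e.2) 0) :=
    LipschitzWith.prod_fst.locallyLipschitz.prodMk
      (hpart.comp LipschitzWith.prod_snd).locallyLipschitz
  have hcomp := hpoly.locallyLipschitz.comp hpair
  unfold flux
  exact hcomp

lemma contDiffOn_potential (v : V → ℝ) (W : Matrix V V ℝ) (β : ℝ) :
    ContDiffOn ℝ 1 (potential v W β) {ρ | ∀ i, 0 < ρ i} := by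
  refine contDiffOn_pi.2 fun i => ?_
  simp only [potential, mulVec, dotProduct]
  have hlog : ContDiffOn ℝ 1 (fun ρ : V → ℝ => Real.log (ρ i)) {ρ | ∀ i, 0 < ρ i} :=
    (contDiff_apply ℝ ℝ i).contDiffOn.log fun ρ hρ => (hρ i).ne'
  fun_prop

section Field

variable [DecidableEq V]

lemma locallyLipschitzOn_schemeRHS (G : SimpleGraph V) [DecidableRel G.Adj] (v : V → ℝ)
    (hW : W.IsSymm) (β Δx : ℝ) :
    LocallyLipschitzOn {ρ | ∀ i, 0 < ρ i} (schemeRHS G v W β Δx) := by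
  have hconvex : Convex ℝ {ρ : V → ℝ | ∀ i, 0 < ρ i} := by
    simpa [Set.pi] using convex_pi (s := univ) fun (_ : V) _ => convex_Ioi (0 : ℝ)
  have hpot := (contDiffOn_id.prodMk (contDiffOn_potential v W β)).locallyLipschitzOn hconvex
  have hscale := (contDiff_const_smul (𝕜 := ℝ) (n := 1) (F := V → ℝ)
    (-(1 / Δx ^ 2))).locallyLipschitz
  have heq : {ρ : V → ℝ | ∀ i, 0 < ρ i}.domRestrict (schemeRHS G v W β Δx) =
      fun ρ => -(1 / Δx ^ 2) • flux G ρ.1 (potential v W β ρ.1) :=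
    funext fun ρ => schemeRHS_eq G hW Δx ρ.2
  rw [locallyLipschitzOn_iff_restrict] at hpot ⊢
  have hcomp := (hscale.comp (locallyLipschitz_flux G)).comp hpot
  rw [heq]
  exact hcomp

lemma sum_schemeRHS (hW : W.IsSymm) (Δx : ℝ) {ρ : V → ℝ} (hρ : ∀ i, 0 < ρ i) :
    ∑ i, schemeRHS G v W β Δx ρ i = 0 := by
  simp only [schemeRHS_eq G hW Δx hρ, Pi.smul_apply, ← Finset.smul_sum, sum_flux, smul_zero]

/-- At a vertex of minimal mass the entropy does not contribute to the outgoing potential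
differences, so only the bounded part of the potential drives mass out of it. -/
lemma exists_neg_mul_lt_schemeRHS (G : SimpleGraph V) [DecidableRel G.Adj] (v : V → ℝ)
    (hW : W.IsSymm) (hβ : 0 ≤ β) (Δx : ℝ) :
    ∃ C > 0, ∀ ρ ∈ posSimplex V, ∀ i, (∀ j, ρ i ≤ ρ j) →
      -C * ρ i < schemeRHS G v W β Δx ρ i := by
  obtain ⟨B, hB₀, hB⟩ := exists_abs_potential_sub_le v W β
  refine ⟨1 / Δx ^ 2 * (Fintype.card V * (2 * B)) + 1, by positivity, fun ρ hρ i hi => ?_⟩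
  have hbound (j : V) := abs_le.1 (hB ρ (posSimplex_subset_stdSimplex hρ) j)
  have hdiff (j : V) : potential v W β ρ i - potential v W β ρ j ≤ 2 * B := by
    have hlog := mul_le_mul_of_nonneg_left (Real.log_le_log (hρ.1 i) (hi j)) hβ
    linarith [(hbound i).2, (hbound j).1]
  have hflux := mul_le_mul_of_nonneg_left
    (flux_apply_le (G := G) (fun j => (hρ.1 j).le) (by positivity) hdiff)
    (show 0 ≤ 1 / Δx ^ 2 by positivity)
  rw [schemeRHS_eq G hW Δx hρ.1, Pi.smul_apply, smul_eq_mul]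
  linarith [hρ.1 i]

lemma exists_hasDerivWithinAt_Icc [Nonempty V] (G : SimpleGraph V) [DecidableRel G.Adj]
    (v : V → ℝ) (hW : W.IsSymm) (hβ : 0 ≤ β) (Δx : ℝ) {ρ₀ : V → ℝ} (hρ₀ : ρ₀ ∈ posSimplex V)
    {T : ℝ} (hT : 0 ≤ T) :
    ∃ γ : ℝ → V → ℝ, γ 0 = ρ₀ ∧ ∀ t ∈ Icc 0 T, γ t ∈ posSimplex V ∧
      HasDerivWithinAt γ (schemeRHS G v W β Δx (γ t)) (Icc 0 T) t := by
  obtain ⟨C, hC, hrate⟩ := exists_neg_mul_lt_schemeRHS G v hW hβ Δx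
  obtain ⟨k, hk⟩ := Finite.exists_min ρ₀
  have hm : 0 < ρ₀ k := hρ₀.1 k
  have hbarrier : ∀ t ∈ Icc 0 T, ρ₀ k * Real.exp (-C * T) ≤ ρ₀ k * Real.exp (-C * t) :=
    fun t ht => mul_le_mul_of_nonneg_left
      (Real.exp_le_exp.2 (mul_le_mul_of_nonpos_left ht.2 (neg_nonpos.2 hC.le))) hm.le
  obtain ⟨γ, γ₁, hγ₀, hγ₁, hγ⟩ := exists_hasDerivWithinAt_of_locallyLipschitzOn
    (locallyLipschitzOn_schemeRHS G v hW β Δx) (fun _ => sum_schemeRHS hW Δx) hρ₀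
    (ε := ρ₀ k * Real.exp (-C * T)) (by positivity)
    (fun i => ((hbarrier 0 ⟨le_rfl, hT⟩).trans (by simp)).trans (hk i)) hT
  have hmem (t : ℝ) (ht : t ∈ Icc 0 T) (hge : ∀ j, ρ₀ k * Real.exp (-C * t) ≤ γ t j) :
      γ t ∈ posSimplex V ∧ γ₁ t = γ t :=
    hγ₁ t ht fun j => (hbarrier t ht).trans (hge j)
  have hge := exp_neg_mul_le_of_hasDerivWithinAt (C := C) hγ (by rwa [hγ₀]) fun t ht hge i hi => by
    obtain ⟨hγt, heq⟩ := hmem t ht hge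
    exact heq ▸ hrate _ hγt i fun j => hi ▸ hge j
  refine ⟨γ, hγ₀, fun t ht => ?_⟩
  obtain ⟨hγt, heq⟩ := hmem t ht (hge t ht)
  exact ⟨hγt, heq ▸ hγ t ht⟩

lemma IsSolution.eqOn (hW : W.IsSymm) {Δx : ℝ} {ρ σ : ℝ → V → ℝ}
    (hρ : IsSolution G v W β Δx ρ) (hσ : IsSolution G v W β Δx σ) (h0 : ρ 0 = σ 0) :
    EqOn ρ σ (Ici 0) := fun T hT =>
  have hIcc {γ : ℝ → V → ℝ} (hγ : IsSolution G v W β Δx γ) (t : ℝ) (ht : t ∈ Icc 0 T) :=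
    (hγ t ht.1).imp And.left fun h => h.mono Icc_subset_Ici_self
  eqOn_Icc_of_locallyLipschitzOn (locallyLipschitzOn_schemeRHS G v hW β Δx)
    (hIcc hρ) (hIcc hσ) h0 ⟨hT, le_rfl⟩

lemma exists_isSolution [Nonempty V] (G : SimpleGraph V) [DecidableRel G.Adj] (v : V → ℝ)
    (hW : W.IsSymm) (hβ : 0 ≤ β) (Δx : ℝ) {ρ₀ : V → ℝ} (hρ₀ : ρ₀ ∈ posSimplex V) :
    ∃ ρ, IsSolution G v W β Δx ρ ∧ ρ 0 = ρ₀ := by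
  choose! γ hγ₀ hγ using fun T (hT : 0 ≤ T) => exists_hasDerivWithinAt_Icc G v hW hβ Δx hρ₀ hT
  have hagree (T t : ℝ) (ht : t ∈ Icc 0 T) : γ t t = γ T t := by
    have hT := ht.1.trans ht.2
    refine eqOn_Icc_of_locallyLipschitzOn (locallyLipschitzOn_schemeRHS G v hW β Δx)
      (fun s hs => (hγ t ht.1 s hs).imp And.left id) (fun s hs => ?_)
      ((hγ₀ t ht.1).trans (hγ₀ T hT).symm) ⟨ht.1, le_rfl⟩
    exact (hγ T hT s ⟨hs.1, hs.2.trans ht.2⟩).imp And.left fun h =>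
      h.mono (Icc_subset_Icc_right ht.2)
  refine ⟨fun t => γ t t, fun t ht => ?_, hγ₀ 0 le_rfl⟩
  have htT : t ∈ Icc 0 (t + 1) := ⟨ht, by linarith⟩
  obtain ⟨hmem, hderiv⟩ := hγ (t + 1) (by linarith) t htT
  rw [← hagree (t + 1) t htT] at hmem hderiv
  refine ⟨hmem, (hderiv.congr (hagree (t + 1)) (hagree (t + 1) t htT)).mono_of_mem_nhdsWithin ?_⟩
  exact inter_mem_nhdsWithin (Ici 0) (Iic_mem_nhds (lt_add_one t))

end Field

end WellPosedness

section LongTime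

lemma le_exp_mul_of_hasDerivWithinAt {f f' : ℝ → ℝ} {k a b : ℝ}
    (hf : ∀ t ∈ Icc a b, HasDerivWithinAt f (f' t) (Icc a b) t)
    (hle : ∀ t ∈ Icc a b, f' t ≤ k * f t) :
    ∀ t ∈ Icc a b, f t ≤ Real.exp (k * (t - a)) * f a := fun t ht => by
  have hgronwall := le_gronwallBound_of_liminf_deriv_right_le (ε := 0)
    (fun s hs => (hf s hs).continuousWithinAt)
    (fun s hs _ => (hasDerivWithinAt_Ici_of_Icc hs
      (hf s (Ico_subset_Icc_self hs))).liminf_right_slope_le)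
    le_rfl (fun s hs => (hle s (Ico_subset_Icc_self hs)).trans_eq (add_zero _).symm) t ht
  rwa [gronwallBound_ε0, mul_comm] at hgronwall

lemma IsGibbs.dist_lt_of_freeEnergy_lt (hW : W.IsSymm) (hα : IsConvexityModulus W β α)
    (hβ : 0 < β) (h0α : 0 < α) {p ρ : V → ℝ} (hp : IsGibbs v W β p) (hρ : ρ ∈ posSimplex V)
    {ε : ℝ} (hε : 0 < ε)
    (hlt : freeEnergy v W β ρ - freeEnergy v W β p < α / 2 * ε ^ 2) : dist ρ p < ε := by
  have hgrowth := (hp.quadratic_growth hW hα hβ hρ).trans_lt hlt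
  rw [dist_eq_norm]
  refine lt_of_pow_lt_pow_left₀ 2 hε.le ((norm_sq_le_dotProduct_self _).trans_lt ?_)
  exact lt_of_mul_lt_mul_left hgrowth (by positivity)

variable [DecidableEq V] {G : SimpleGraph V} [DecidableRel G.Adj] {p : V → ℝ} {Δx : ℝ}
  {ρ : ℝ → V → ℝ}

lemma IsSolution.hasDerivWithinAt_freeEnergy (hW : W.IsSymm) (hρ : IsSolution G v W β Δx ρ) {t : ℝ}
    (ht : 0 ≤ t) : HasDerivWithinAt (fun t => freeEnergy v W β (ρ t))
      (-(dirichlet G (ρ t) (potential v W β (ρ t)) / Δx ^ 2)) (Ici 0) t := by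
  obtain ⟨hmem, hderiv⟩ := hρ t ht
  refine (GraphFlow.hasDerivWithinAt_freeEnergy hW hderiv hmem.1).congr_deriv ?_
  rw [schemeRHS_eq G hW Δx hmem.1, dotProduct_smul, dotProduct_flux_self, smul_eq_mul]
  ring

lemma IsSolution.freeEnergy_sub_le_exp_mul (hW : W.IsSymm) (hΔx : 0 < Δx)
    (hρ : IsSolution G v W β Δx ρ) {e k T : ℝ} (hT : 0 ≤ T)
    (hle : ∀ t, T ≤ t → k * Δx ^ 2 * (freeEnergy v W β (ρ t) - e) ≤
      dirichlet G (ρ t) (potential v W β (ρ t))) {t : ℝ} (ht : T ≤ t) :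
    freeEnergy v W β (ρ t) - e ≤ Real.exp (-k * (t - T)) * (freeEnergy v W β (ρ T) - e) := by
  refine le_exp_mul_of_hasDerivWithinAt (fun s hs => ((hρ.hasDerivWithinAt_freeEnergy hW
    (hT.trans hs.1)).sub_const e).mono fun r hr => hT.trans hr.1) (fun s hs => ?_) t ⟨ht, le_rfl⟩
  rw [neg_mul, neg_le_neg_iff, le_div_iff₀ (by positivity)]
  linarith [hle s hs.1]

lemma IsSolution.freeEnergy_le (hW : W.IsSymm) (hΔx : 0 < Δx) (hρ : IsSolution G v W β Δx ρ)
    {t : ℝ} (ht : 0 ≤ t) : freeEnergy v W β (ρ t) ≤ freeEnergy v W β (ρ 0) := by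
  have hle := hρ.freeEnergy_sub_le_exp_mul hW hΔx (e := 0) (k := 0) le_rfl
    (fun s hs => by simpa using dirichlet_nonneg G (fun i => ((hρ s hs).1.1 i).le) _) ht
  simpa using hle

lemma IsGibbs.schemeRHS_eq_zero (hW : W.IsSymm) (hβ : β ≠ 0) (hp : IsGibbs v W β p) :
    schemeRHS G v W β Δx p = 0 := by
  obtain ⟨hmem, heq⟩ := (isGibbs_iff hβ).1 hp
  ext i
  simp [schemeRHS_eq G hW Δx hmem.1, flux, heq _ i]

lemma IsGibbs.lyapunov_stable (hW : W.IsSymm) (hα : IsConvexityModulus W β α) (hβ : 0 < β)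
    (h0α : 0 < α) (hΔx : 0 < Δx) (hp : IsGibbs v W β p) {ε : ℝ} (hε : 0 < ε) :
    ∃ δ > 0, ∀ ρ, IsSolution G v W β Δx ρ → dist (ρ 0) p < δ → ∀ t, 0 ≤ t → dist (ρ t) p < ε := by
  have hsub := ((continuous_freeEnergy v W β).tendsto p).sub_const (freeEnergy v W β p)
  rw [sub_self] at hsub
  obtain ⟨δ, hδ, hlt⟩ := Metric.eventually_nhds_iff.1
    (hsub.eventually_lt_const (show 0 < α / 2 * ε ^ 2 by positivity))
  refine ⟨δ, hδ, fun ρ hρ hdist t ht =>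
    hp.dist_lt_of_freeEnergy_lt hW hα hβ h0α (hρ t ht).1 hε (lt_of_le_of_lt ?_ (hlt hdist))⟩
  exact sub_le_sub_right (hρ.freeEnergy_le hW hΔx ht) _

lemma exists_freeEnergy_sub_le_exp_mul (hG : G.Connected) (hW : W.IsSymm)
    (hα : IsConvexityModulus W β α) (hβ : 0 < β) (h0α : 0 < α) (hΔx : 0 < Δx)
    (hp : p ∈ stdSimplex ℝ V) :
    ∃ C > 0, ∀ ρ, IsSolution G v W β Δx ρ → ∀ t, 0 ≤ t →
      freeEnergy v W β (ρ t) - freeEnergy v W β p ≤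
        Real.exp (-C * t) * (freeEnergy v W β (ρ 0) - freeEnergy v W β p) := by
  obtain ⟨K, hK, hle⟩ := exists_freeEnergy_sub_le_mul_dirichlet hG hW hα hβ h0α v hp
  refine ⟨1 / (K * Δx ^ 2), by positivity, fun ρ hρ t ht => ?_⟩
  have hdecay := hρ.freeEnergy_sub_le_exp_mul hW hΔx (e := freeEnergy v W β p)
    (k := 1 / (K * Δx ^ 2)) le_rfl (fun s hs => ?_) ht
  · rwa [sub_zero] at hdecay
  · have hinv : 1 / (K * Δx ^ 2) * Δx ^ 2 = K⁻¹ := by field_simp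
    rw [hinv, inv_mul_le_iff₀ hK]
    exact hle _ (hρ s hs).1

lemma IsGibbs.exists_forall_dist_lt (hG : G.Connected) (hW : W.IsSymm)
    (hα : IsConvexityModulus W β α) (hβ : 0 < β) (h0α : 0 < α) (hΔx : 0 < Δx)
    (hp : IsGibbs v W β p) {ε : ℝ} (hε : 0 < ε) :
    ∃ T > 0, ∀ ρ, IsSolution G v W β Δx ρ → ∀ t, T ≤ t → dist (ρ t) p < ε := by
  obtain ⟨C, hC, hdecay⟩ := exists_freeEnergy_sub_le_exp_mul (v := v) hG hW hα hβ h0α hΔx hp.1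
  obtain ⟨M, hM⟩ := (isCompact_stdSimplex ℝ V).bddAbove_image
    (continuous_freeEnergy v W β).continuousOn
  have hlim : Tendsto (fun t => Real.exp (-C * t) * (M - freeEnergy v W β p)) atTop (𝓝 0) := by
    simpa using (Real.tendsto_exp_atBot.comp (tendsto_id.const_mul_atTop_of_neg
      (neg_neg_of_pos hC))).mul_const (M - freeEnergy v W β p)
  obtain ⟨T, hT⟩ := eventually_atTop.1
    (hlim.eventually_lt_const (show 0 < α / 2 * ε ^ 2 by positivity))
  refine ⟨max T 1, by positivity, fun ρ hρ t ht => ?_⟩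
  have ht₀ : 0 ≤ t := zero_le_one.trans (le_of_max_le_right ht)
  have hle : freeEnergy v W β (ρ 0) ≤ M :=
    hM ⟨ρ 0, posSimplex_subset_stdSimplex (hρ 0 le_rfl).1, rfl⟩
  refine hp.dist_lt_of_freeEnergy_lt hW hα hβ h0α (hρ t ht₀).1 hε ?_
  calc freeEnergy v W β (ρ t) - freeEnergy v W β p
      ≤ Real.exp (-C * t) * (freeEnergy v W β (ρ 0) - freeEnergy v W β p) := hdecay ρ hρ t ht₀
    _ ≤ Real.exp (-C * t) * (M - freeEnergy v W β p) := by gcongr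
    _ < α / 2 * ε ^ 2 := hT t (le_of_max_le_left ht)

lemma IsGibbs.isGlobalAttractor (hG : G.Connected) (hW : W.IsSymm) (hα : IsConvexityModulus W β α)
    (hβ : 0 < β) (h0α : 0 < α) (hΔx : 0 < Δx) (hp : IsGibbs v W β p) :
    IsGlobalAttractor G v W β Δx p where
  mem := ((isGibbs_iff hβ.ne').1 hp).1
  equilibrium := hp.schemeRHS_eq_zero hW hβ.ne'
  stable _ hε := hp.lyapunov_stable hW hα hβ h0α hΔx hε
  converges ρ hρ := Metric.tendsto_atTop.2 fun _ hε =>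
    (hp.exists_forall_dist_lt hG hW hα hβ h0α hΔx hε).imp fun _ hT => hT.2 ρ hρ
  uniform _ hε := hp.exists_forall_dist_lt hG hW hα hβ h0α hΔx hε

lemma IsRate.exists_freeEnergy_sub_le_exp_mul {lam : ℝ} (hG : G.Connected) (hW : W.IsSymm)
    (hα : IsConvexityModulus W β α) (hβ : 0 < β) (h0α : 0 < α) (hΔx : 0 < Δx)
    (hlam : IsRate G v W β Δx p lam) (hp : IsGibbs v W β p) (hρ : IsSolution G v W β Δx ρ) {ε : ℝ}
    (hε : 0 < ε) :
    ∃ T > 0, ∀ t, T ≤ t → freeEnergy v W β (ρ t) - freeEnergy v W β p ≤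
      Real.exp (-2 * (lam - ε) * (t - T)) * (freeEnergy v W β (ρ T) - freeEnergy v W β p) := by
  have hmem := ((isGibbs_iff hβ.ne').1 hp).1
  have hκ : ∀ δ, ∑ i, δ i = 0 →
      lam * Δx ^ 2 * (δ ⬝ᵥ hessian W β p *ᵥ δ) ≤ dirichlet G p (hessian W β p *ᵥ δ) := fun δ =>
    mul_dotProduct_mulVec_le_dirichlet hG
      (mul_nonneg (hlam.pos hW hα hβ.le h0α hΔx hmem).le (sq_nonneg Δx)) hmem.1
      (hlam.mul_dirichlet_le hW hα hβ.le h0α.le hΔx hmem)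
  have hlim : Tendsto ρ atTop (𝓝[posSimplex V] p) := tendsto_nhdsWithin_iff.2
    ⟨(hp.isGlobalAttractor hG hW hα hβ h0α hΔx).converges ρ hρ,
      (eventually_ge_atTop 0).mono fun t ht => (hρ t ht).1⟩
  obtain ⟨T, hT⟩ := eventually_atTop.1 (hlim.eventually
    (hp.eventually_mul_freeEnergy_sub_le_dirichlet hW hα hβ h0α hκ
      (show 0 < ε * Δx ^ 2 by positivity)))
  refine ⟨max T 1, by positivity, fun t ht => ?_⟩
  rw [neg_mul 2]
  refine hρ.freeEnergy_sub_le_exp_mul hW hΔx (by positivity) (fun s hs => ?_) ht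
  refine le_of_eq_of_le ?_ (hT s (le_of_max_le_left hs))
  ring

end LongTime

end GraphFlow

end

theorem corollary3p4_general {V : Type*} [Fintype V] [DecidableEq V] [Nontrivial V]
    (G : SimpleGraph V) [DecidableRel G.Adj] (hG : G.Connected)
    (v : V → ℝ) (W : Matrix V V ℝ) (hW : W.IsSymm)
    (α β Δx : ℝ) (hα : GraphFlow.IsConvexityModulus W β α) (h0α : 0 < α) (hβ : 0 < β)
    (hΔx : 0 < Δx) :
    (∀ ρ₀ ∈ GraphFlow.posSimplex V, ∃ ρ : ℝ → V → ℝ,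
      GraphFlow.IsSolution G v W β Δx ρ ∧ ρ 0 = ρ₀ ∧
      ∀ σ : ℝ → V → ℝ, GraphFlow.IsSolution G v W β Δx σ → σ 0 = ρ₀ →
        Set.EqOn σ ρ (Set.Ici 0)) ∧
    ∃ ρinf : V → ℝ,
      GraphFlow.IsGibbs v W β ρinf ∧
      (∀ σ : V → ℝ, GraphFlow.IsGibbs v W β σ → σ = ρinf) ∧
      GraphFlow.IsGlobalAttractor G v W β Δx ρinf ∧
      (∃ C > 0, ∀ ρ : ℝ → V → ℝ, GraphFlow.IsSolution G v W β Δx ρ → ∀ t, 0 ≤ t →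
        GraphFlow.freeEnergy v W β (ρ t) - GraphFlow.freeEnergy v W β ρinf ≤
          Real.exp (-C * t) *
            (GraphFlow.freeEnergy v W β (ρ 0) - GraphFlow.freeEnergy v W β ρinf)) ∧
      ∃ lam : ℝ, GraphFlow.IsRate G v W β Δx ρinf lam ∧ 0 < lam ∧
        ∀ ρ : ℝ → V → ℝ, GraphFlow.IsSolution G v W β Δx ρ → ∀ ε > 0, ∃ T > 0, ∀ t, T ≤ t →
          GraphFlow.freeEnergy v W β (ρ t) - GraphFlow.freeEnergy v W β ρinf ≤
            Real.exp (-2 * (lam - ε) * (t - T)) *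
              (GraphFlow.freeEnergy v W β (ρ T) - GraphFlow.freeEnergy v W β ρinf) := by
  obtain ⟨p, hp⟩ := GraphFlow.exists_isGibbs hW hα hβ h0α.le v
  have hpos := ((GraphFlow.isGibbs_iff hβ.ne').1 hp).1
  obtain ⟨lam, hlam⟩ := GraphFlow.exists_isRate (v := v) (β := β) hG hW hΔx hpos.1
  refine ⟨fun ρ₀ hρ₀ => ?_, p, hp, fun σ hσ => hσ.unique hW hα hβ h0α hp,
    hp.isGlobalAttractor hG hW hα hβ h0α hΔx,
    GraphFlow.exists_freeEnergy_sub_le_exp_mul hG hW hα hβ h0α hΔx hp.1, lam, hlam,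
    hlam.pos hW hα hβ.le h0α hΔx hpos,
    fun ρ hρ ε hε => hlam.exists_freeEnergy_sub_le_exp_mul hG hW hα hβ h0α hΔx hp hρ hε⟩
  obtain ⟨ρ, hρ, hρ_init⟩ := GraphFlow.exists_isSolution G v hW hβ.le Δx hρ₀
  exact ⟨ρ, hρ, hρ_init, fun σ hσ hσ_init => hσ.eqOn hW hρ (hσ_init.trans hρ_init.symm)⟩

theorem corollary3p4 {V : Type*} [Fintype V] [DecidableEq V] [Nontrivial V]
    (G : SimpleGraph V) [DecidableRel G.Adj] (hG : G.Connected)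
    (v : V → ℝ) (W : Matrix V V ℝ) (hW : W.PosSemidef)
    (β Δx : ℝ) (hβ : 0 < β) (hΔx : 0 < Δx) :
    (∀ ρ₀ ∈ GraphFlow.posSimplex V, ∃ ρ : ℝ → V → ℝ,
      GraphFlow.IsSolution G v W β Δx ρ ∧ ρ 0 = ρ₀ ∧
      ∀ σ : ℝ → V → ℝ, GraphFlow.IsSolution G v W β Δx σ → σ 0 = ρ₀ →
        Set.EqOn σ ρ (Set.Ici 0)) ∧
    ∃ ρinf : V → ℝ,
      GraphFlow.IsGibbs v W β ρinf ∧
      (∀ σ : V → ℝ, GraphFlow.IsGibbs v W β σ → σ = ρinf) ∧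
      GraphFlow.IsGlobalAttractor G v W β Δx ρinf ∧
      (∃ C > 0, ∀ ρ : ℝ → V → ℝ, GraphFlow.IsSolution G v W β Δx ρ → ∀ t, 0 ≤ t →
        GraphFlow.freeEnergy v W β (ρ t) - GraphFlow.freeEnergy v W β ρinf ≤
          Real.exp (-C * t) *
            (GraphFlow.freeEnergy v W β (ρ 0) - GraphFlow.freeEnergy v W β ρinf)) ∧
      ∃ lam : ℝ, GraphFlow.IsRate G v W β Δx ρinf lam ∧ 0 < lam ∧
        ∀ ρ : ℝ → V → ℝ, GraphFlow.IsSolution G v W β Δx ρ → ∀ ε > 0, ∃ T > 0, ∀ t, T ≤ t →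
          GraphFlow.freeEnergy v W β (ρ t) - GraphFlow.freeEnergy v W β ρinf ≤
            Real.exp (-2 * (lam - ε) * (t - T)) *
              (GraphFlow.freeEnergy v W β (ρ T) - GraphFlow.freeEnergy v W β ρinf) := by
  exact corollary3p4_general G hG v W (Matrix.isHermitian_iff_isSymm.1 hW.isHermitian) β β Δx
    (GraphFlow.isConvexityModulus_of_posSemidef hW β) hβ hβ hΔx
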